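/- A discounted game on $n\ge 1$ nodes consists of a directed graph $G=(V,E)$, $E\subseteq V\times V$, $|V|=n$, in which every node has an out-going edge, a partition $V=V_{\mathrm{Max}}\sqcup V_{\mathrm{Min}}$, weights $w\colon E\to\mathbb{R}$ and a discount factor $\lambda\in(0,1)$. Its vector of values is the unique solution $x\in\mathbb{R}^V$ of the optimality equations $x_a=\max_{(a,b)\in E}(w(a,b)+\lambda x_b)$ for $a\in V_{\mathrm{Max}}$ and $x_a=\min_{(a,b)\in E}(w(a,b)+\lambda x_b)$ for $a\in V_{\mathrm{Min}}$. **Theorem 1.** (A) There is a deterministic algorithm that, for every $n\ge1$ and every discounted game on $n$ nodes with arbitrary real weights and arbitrary real discount factor, finds the vector of values in time $n^{O(1)}\cdot(2+\sqrt2)^n$ and space $n^{O(1)}$, where the basic arithmetic operations and comparisons of real numbers are carried out by an oracle at unit cost. More precisely, there are a single program and constants $C,k$ such that the program makes at most $Cn^k(2+\sqrt2)^n$ steps and uses at most $Cn^k$ cells in each of its arrays, and all the natural numbers (addresses, counters) that it stores are below $Cn^k$. Moreover, if $\lambda$ and all the weights are rational of bit-length at most $B$, then all the real numbers stored during the computation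 are rational of bit-length at most $C(nB)^k$. (B) For a directed graph $H$ on $V$ (sinks allowed) let $\delta_H\in\mathbb{R}^V$ be the unique vector such that $\delta_H(a)=-1$ for sinks $a\in V_{\mathrm{Max}}$, $\delta_H(a)=1$ for sinks $a\in V_{\mathrm{Min}}$, and at every other node $\delta_H(a)=\lambda\max_{(a,b)\in H}\delta_H(b)$ if $a\in V_{\mathrm{Max}}$, $\delta_H(a)=\lambda\min_{(a,b)\in H}\delta_H(b)$ if $a\in V_{\mathrm{Min}}$. A graph $K$ on $V$ is obtained from $H$ in one step of DNP games iteration if $K$ contains every edge $(a,b)$ of $H$ with $\delta_H(a)=\lambda\delta_H(b)$, and $K$ contains a pair $(a,b)$ with $a\in V_{\mathrm{Max}}$, $\delta_H(a)<\lambda\delta_H(b)$ or with $a\in V_{\mathrm{Min}}$, $\delta_H(a)>\lambda\delta_H(b)$. The optimality polyhedron of a discounted game is the set of $x\in\mathbb{R}^V$ with $x_a\ge w(a,b)+\lambda x_b$ for all edges $(a,b)$ with $a\in V_{\mathrm{Max}}$ and $x_a\le w(a,b)+\lambda x_b$ for all edges with $a\in V_{\mathrm{Min}}$; $E_x$ is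 the set of edges for which equality holds at $x$, and $\delta_x:=\delta_{(V,E_x)}$. One step of polyhedral value iteration goes from a point $x$ of the polyhedron that does not satisfy the optimality equations to any point $x'$ of the polyhedron with $E_{x+\varepsilon\delta_x}\subseteq E_{x'}$, where $\varepsilon>0$ is the largest number such that $x+\varepsilon\delta_x$ is in the polyhedron. Then: such a step is possible from every point of the polyhedron that does not satisfy the optimality equations; $(V,E_{x'})$ is always obtained from $(V,E_x)$ in one step of DNP games iteration; and every sequence of graphs on $n\ge1$ nodes in which each next graph is obtained from the previous one in one step of DNP games iteration (with a fixed partition and a fixed $\lambda$) has length $O(n(2+\sqrt2)^n)$, with an absolute constant. -/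

import Mathlib

/-- The two players. -/
inductive Player where
  | max
  | min

/-- A discounted game on the nodes `0, …, n - 1`: a directed graph (loops allowed) in which every node
has an out-going edge, the owner of each node, real edge weights, and a real discount factor in `(0, 1)`.
Only the values `w a b` on edges `(a, b)` are ever used. -/
structure DiscountedGame (n : ℕ) where
  E : Fin n → Fin n → Prop
  owner : Fin n → Player
  w : Fin n → Fin n → ℝ
  lam : ℝ
  lam_pos : 0 < lam
  lam_lt_one : lam < 1
  exists_edge : ∀ a, ∃ b, E a b

/-- The optimality equations: `x a` is the maximum (for a node of Max) or the minimum
(for a node of Min) of `w a b + lam * x b` over the edges `(a, b)`. -/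
def DiscountedGame.OptimalityEquations {n : ℕ} (G : DiscountedGame n) (x : Fin n → ℝ) : Prop :=
  (∀ a, G.owner a = Player.max → IsGreatest {r | ∃ b, G.E a b ∧ r = G.w a b + G.lam * x b} (x a)) ∧
  (∀ a, G.owner a = Player.min → IsLeast {r | ∃ b, G.E a b ∧ r = G.w a b + G.lam * x b} (x a))

/-- `x` is the vector of values: the unique solution of the optimality equations. -/
def DiscountedGame.IsValueVector {n : ℕ} (G : DiscountedGame n) (x : Fin n → ℝ) : Prop :=
  G.OptimalityEquations x ∧ ∀ y, G.OptimalityEquations y → y = x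

/-! ### The machine model: programs over natural-number arrays and real arrays

A program refers to finitely many named arrays of two sorts. Arrays of natural numbers serve for
control flow, graphs and addresses; arrays of reals can be accessed only by the arithmetic operations and
comparisons (the arithmetic oracle). Every operation costs one step. -/

/-- A memory: `N k i` is cell `i` of the `k`-th natural-number array, `R k i` is cell `i` of
the `k`-th real array. -/
structure Mem where
  N : ℕ → ℕ → ℕ
  R : ℕ → ℕ → ℝ

/-- Natural-number expressions (`sub` is truncated). -/
inductive NExp where
  | lit (m : ℕ)
  | get (k : ℕ) (i : NExp)
  | add (e f : NExp)
  | sub (e f : NExp)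
  | mul (e f : NExp)

def NExp.eval (s : Mem) : NExp → ℕ
  | .lit m => m
  | .get k i => s.N k (i.eval s)
  | .add e f => e.eval s + f.eval s
  | .sub e f => e.eval s - f.eval s
  | .mul e f => e.eval s * f.eval s

/-- Number of operations needed to evaluate an expression. -/
def NExp.cost : NExp → ℕ
  | .lit _ => 1
  | .get _ i => i.cost + 1
  | .add e f => e.cost + f.cost + 1
  | .sub e f => e.cost + f.cost + 1
  | .mul e f => e.cost + f.cost + 1

/-- Real expressions. The only constants are natural numbers. -/
inductive RExp where
  | lit (m : ℕ)
  | get (k : ℕ) (i : NExp)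
  | add (e f : RExp)
  | sub (e f : RExp)
  | mul (e f : RExp)
  | div (e f : RExp)

noncomputable def RExp.eval (s : Mem) : RExp → ℝ
  | .lit m => (m : ℝ)
  | .get k i => s.R k (i.eval s)
  | .add e f => e.eval s + f.eval s
  | .sub e f => e.eval s - f.eval s
  | .mul e f => e.eval s * f.eval s
  | .div e f => e.eval s / f.eval s

def RExp.cost : RExp → ℕ
  | .lit _ => 1
  | .get _ i => i.cost + 1
  | .add e f => e.cost + f.cost + 1
  | .sub e f => e.cost + f.cost + 1
  | .mul e f => e.cost + f.cost + 1
  | .div e f => e.cost + f.cost + 1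

/-- Tests. -/
inductive BExp where
  | ltN (e f : NExp)
  | ltR (e f : RExp)
  | not (b : BExp)
  | and (b c : BExp)

def BExp.Holds (s : Mem) : BExp → Prop
  | .ltN e f => e.eval s < f.eval s
  | .ltR e f => e.eval s < f.eval s
  | .not b => ¬ b.Holds s
  | .and b c => b.Holds s ∧ c.Holds s

def BExp.cost : BExp → ℕ
  | .ltN e f => e.cost + f.cost + 1
  | .ltR e f => e.cost + f.cost + 1
  | .not b => b.cost + 1
  | .and b c => b.cost + c.cost + 1

/-- Programs. `setN k i e` is the assignment `N k [i] := e`, and `loop b c` is `while b do c`. -/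
inductive Prog where
  | skip
  | setN (k : ℕ) (i e : NExp)
  | setR (k : ℕ) (i : NExp) (e : RExp)
  | seq (c d : Prog)
  | ite (b : BExp) (c d : Prog)
  | loop (b : BExp) (c : Prog)

/-- Store `v` in cell `i` of the `k`-th natural-number array. -/
def Mem.writeN (s : Mem) (k i v : ℕ) : Mem :=
  { s with N := Function.update s.N k (Function.update (s.N k) i v) }

/-- Store `v` in cell `i` of the `k`-th real array. -/
def Mem.writeR (s : Mem) (k i : ℕ) (v : ℝ) : Mem :=
  { s with R := Function.update s.R k (Function.update (s.R k) i v) }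

/-- `Exec I c s t s'`: the program `c`, started in the memory `s`, halts after exactly `t` steps in the
memory `s'`, and all memories met during the execution (`s` and `s'` included) satisfy `I`. -/
inductive Exec (I : Mem → Prop) : Prog → Mem → ℕ → Mem → Prop where
  | skip (s : Mem) : I s → Exec I .skip s 1 s
  | setN (s : Mem) (k : ℕ) (i e : NExp) : I s → I (s.writeN k (i.eval s) (e.eval s)) →
      Exec I (.setN k i e) s (i.cost + e.cost + 1) (s.writeN k (i.eval s) (e.eval s))
  | setR (s : Mem) (k : ℕ) (i : NExp) (e : RExp) : I s → I (s.writeR k (i.eval s) (e.eval s)) →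
      Exec I (.setR k i e) s (i.cost + e.cost + 1) (s.writeR k (i.eval s) (e.eval s))
  | seq (s s₁ s₂ : Mem) (t₁ t₂ : ℕ) (c d : Prog) : Exec I c s t₁ s₁ → Exec I d s₁ t₂ s₂ →
      Exec I (.seq c d) s (t₁ + t₂) s₂
  | iteTrue (s s' : Mem) (t : ℕ) (b : BExp) (c d : Prog) : b.Holds s → Exec I c s t s' →
      Exec I (.ite b c d) s (b.cost + 1 + t) s'
  | iteFalse (s s' : Mem) (t : ℕ) (b : BExp) (c d : Prog) : ¬ b.Holds s → Exec I d s t s' →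
      Exec I (.ite b c d) s (b.cost + 1 + t) s'
  | loopStop (s : Mem) (b : BExp) (c : Prog) : I s → ¬ b.Holds s →
      Exec I (.loop b c) s (b.cost + 1) s
  | loopStep (s s₁ s₂ : Mem) (t₁ t₂ : ℕ) (b : BExp) (c : Prog) : b.Holds s → Exec I c s t₁ s₁ →
      Exec I (.loop b c) s₁ t₂ s₂ → Exec I (.loop b c) s (b.cost + 1 + t₁ + t₂) s₂

/-- Execution is deterministic. -/
theorem Exec.deterministic {I J : Mem → Prop} {c : Prog} {s s₁ s₂ : Mem} {t₁ t₂ : ℕ}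
    (h₁ : Exec I c s t₁ s₁) (h₂ : Exec J c s t₂ s₂) : t₁ = t₂ ∧ s₁ = s₂ := by
  induction h₁ generalizing t₂ s₂ with
  | skip => cases h₂; exact ⟨rfl, rfl⟩
  | setN => cases h₂; exact ⟨rfl, rfl⟩
  | setR => cases h₂; exact ⟨rfl, rfl⟩
  | seq _ _ _ _ _ _ _ _ _ ih₁ ih₂ =>
    cases h₂ with
    | seq _ _ _ _ _ _ _ a b =>
      obtain ⟨rfl, rfl⟩ := ih₁ a
      obtain ⟨rfl, rfl⟩ := ih₂ b
      exact ⟨rfl, rfl⟩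
  | iteTrue _ _ _ _ _ _ hb _ ih =>
    cases h₂ with
    | iteTrue _ _ _ _ _ _ _ a => obtain ⟨rfl, rfl⟩ := ih a; exact ⟨rfl, rfl⟩
    | iteFalse _ _ _ _ _ _ hn _ => exact absurd hb hn
  | iteFalse _ _ _ _ _ _ hb _ ih =>
    cases h₂ with
    | iteTrue _ _ _ _ _ _ hn _ => exact absurd hn hb
    | iteFalse _ _ _ _ _ _ _ a => obtain ⟨rfl, rfl⟩ := ih a; exact ⟨rfl, rfl⟩
  | loopStop _ _ _ _ hb =>
    cases h₂ with
    | loopStop => exact ⟨rfl, rfl⟩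
    | loopStep _ _ _ _ _ _ _ hn _ _ => exact absurd hn hb
  | loopStep _ _ _ _ _ _ _ hb _ _ ih₁ ih₂ =>
    cases h₂ with
    | loopStop _ _ _ _ hn => exact absurd hb hn
    | loopStep _ _ _ _ _ _ _ _ a b =>
      obtain ⟨rfl, rfl⟩ := ih₁ a
      obtain ⟨rfl, rfl⟩ := ih₂ b
      exact ⟨rfl, rfl⟩

/-- The memory fits in space `S`: in every array only cells with address less than `S` are used
(the others hold `0`), and every natural number in the memory is less than `S`. -/
def Mem.FitsIn (s : Mem) (S : ℕ) : Prop :=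
  (∀ k i, S ≤ i → s.N k i = 0 ∧ s.R k i = 0) ∧ ∀ k i, s.N k i < S

/-- `x` is a rational number of bit-length at most `B` (numerator plus denominator, in lowest terms). -/
def HasBitLength (B : ℕ) (x : ℝ) : Prop :=
  ∃ q : ℚ, (q : ℝ) = x ∧ Nat.size q.num.natAbs + Nat.size q.den ≤ B

/-- The discount factor and all the edge weights are rationals of bit-length at most `B`. -/
def DiscountedGame.HasBitLength {n : ℕ} (G : DiscountedGame n) (B : ℕ) : Prop :=
  _root_.HasBitLength B G.lam ∧ ∀ a b, G.E a b → _root_.HasBitLength B (G.w a b)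

open Classical in
/-- The memory that holds the input `G` and zeros elsewhere: `N 0 [0]` is the number of nodes,
`N 1 [a]` is `1` or `0` according to whether the node `a` belongs to Max or to Min, `N 2` holds the
adjacency matrix (entry `(a, b)` at address `a * n + b`), `R 0 [0]` is the discount factor, and `R 1`
holds the weights of the edges in the same order as the adjacency matrix. -/
noncomputable def DiscountedGame.input {n : ℕ} (G : DiscountedGame n) : Mem where
  N := fun k i =>
    if k = 0 ∧ i = 0 then n
    else if k = 1 ∧ (∃ a : Fin n, G.owner a = Player.max ∧ i = a) then 1
    else if k = 2 ∧ (∃ a b : Fin n, G.E a b ∧ i = a * n + b) then 1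
    else 0
  R := fun k i =>
    if k = 0 ∧ i = 0 then G.lam
    else if k = 1 then ∑ a : Fin n, ∑ b : Fin n, if G.E a b ∧ i = a * n + b then G.w a b else 0
    else 0

/-- The output of a computation on a game with `n` nodes is read from the array `R 2`. -/
def Mem.output (s : Mem) (n : ℕ) : Fin n → ℝ := fun a => s.R 2 a

/-! ### Discounted normal play games and polyhedral value iteration -/

/-- `δ` is the vector of values of the discounted normal play game with discount factor `lam` on the
directed graph `H`, in which a player who cannot move after `s` moves pays `lam ^ s` to the opponent. -/
def IsDNPValue {n : ℕ} (lam : ℝ) (owner : Fin n → Player) (H : Fin n → Fin n → Prop)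
    (δ : Fin n → ℝ) : Prop :=
  ∀ a,
    (owner a = Player.max → (∀ b, ¬ H a b) → δ a = -1) ∧
    (owner a = Player.min → (∀ b, ¬ H a b) → δ a = 1) ∧
    (owner a = Player.max → (∃ b, H a b) → IsGreatest {r | ∃ b, H a b ∧ r = lam * δ b} (δ a)) ∧
    (owner a = Player.min → (∃ b, H a b) → IsLeast {r | ∃ b, H a b ∧ r = lam * δ b} (δ a))

/-- `K` can be obtained from `H` in one step of DNP games iteration: `K` contains all the optimal
edges of `H` and at least one pair that is violating for `H`. -/
def DNPStep {n : ℕ} (lam : ℝ) (owner : Fin n → Player) (H K : Fin n → Fin n → Prop) : Prop :=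
  ∃ δ, IsDNPValue lam owner H δ ∧
    (∀ a b, H a b → δ a = lam * δ b → K a b) ∧
    ∃ a b, K a b ∧
      ((owner a = Player.max ∧ δ a < lam * δ b) ∨ (owner a = Player.min ∧ lam * δ b < δ a))

/-- The optimality polyhedron. -/
def DiscountedGame.optPol {n : ℕ} (G : DiscountedGame n) : Set (Fin n → ℝ) :=
  {x | ∀ a b, G.E a b →
    (G.owner a = Player.max → G.w a b + G.lam * x b ≤ x a) ∧
    (G.owner a = Player.min → x a ≤ G.w a b + G.lam * x b)}

/-- The graph of the edges that are tight for `x`. -/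
def DiscountedGame.tight {n : ℕ} (G : DiscountedGame n) (x : Fin n → ℝ) (a b : Fin n) : Prop :=
  G.E a b ∧ x a = G.w a b + G.lam * x b

/-- One iteration of polyhedral value iteration: from a point `x` of the optimality polyhedron that does
not satisfy the optimality equations, move as far as possible inside the polyhedron along the values `δ`
of the DNP game on the tight edges, and pass from the point reached to any point `x'` of the polyhedron
at which all of its tight edges are still tight. -/
def DiscountedGame.PolyStep {n : ℕ} (G : DiscountedGame n) (x x' : Fin n → ℝ) : Prop :=
  x ∈ G.optPol ∧ ¬ G.OptimalityEquations x ∧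
  ∃ (δ : Fin n → ℝ) (ε : ℝ), IsDNPValue G.lam G.owner (G.tight x) δ ∧
    IsGreatest {ε | 0 < ε ∧ x + ε • δ ∈ G.optPol} ε ∧
    x' ∈ G.optPol ∧ ∀ a b, G.tight (x + ε • δ) a b → G.tight x' a b

/-! The nonzero values of a discounted normal play game are `± lam ^ s` with `s < n`, and the
exponents that occur with a given sign form an initial segment, because an optimal move divides the
value by `lam`. Attach to the positive values their level profile: for each `s`, the number of Max
nodes and of Min nodes of value `lam ^ s`. At the first level where two successive graphs of a DNP
games iteration differ, Max nodes can only join and Min nodes can only leave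
(`IsDNPValue.level_subset`), so the profile never decreases lexicographically. Negating values and
swapping the players gives the same for the negative levels, and a violating edge forces one of the
two profiles to change (`DNPStep.profileKey_lt`). The length of an iteration is therefore at most
twice the number of profiles, which a generating function argument bounds by `(n + 1) * (2 + √2) ^
n` (`card_allProfiles_le`).

In polyhedral value iteration the optimal edges of the DNP game on the tight edges stay tight along
`δ`, and the edge that blocks the move is violating. So the tight graphs form a DNP games iteration
(`PolyStep.dnpStep`), and the bound applies to them.

The program performs this iteration with `x' = x + ε • δ`. It starts from a point equal to `± t`
according to the owner, computes `δ` by `n` rounds of dynamic programming on games stopped early,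
and finds `ε` by a ratio test. Bit-lengths do not accumulate over the exponentially many iterations:
at the sinks of the tight graph the point remains `± t`, so `x + t • δ` solves an affine recurrence
along optimal edges, and `t` is then recovered from the newly tight edge (`isShort_of_tight`). Every
point visited is thus an expression of polynomial size in the input, whatever the iteration number.
-/

/-! ### Signs that treat both players at once. -/

def Player.sgn : Player → ℝ
  | .max => 1
  | .min => -1

def Player.swap : Player → Player
  | .max => .min
  | .min => .max

theorem Player.sgn_swap (p : Player) : p.swap.sgn = -p.sgn := by
  cases p <;> simp [Player.sgn, Player.swap]

theorem Player.sgn_mul_self (p : Player) : p.sgn * p.sgn = 1 := by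
  cases p <;> simp [Player.sgn]

theorem Player.abs_sgn (p : Player) : |p.sgn| = 1 := by
  cases p <;> simp [Player.sgn]

theorem Player.sgn_mul_sgn_mul (p : Player) (r : ℝ) : p.sgn * (p.sgn * r) = r := by
  rw [← mul_assoc, p.sgn_mul_self, one_mul]

theorem Player.sgn_mul_inj (p : Player) {r s : ℝ} : p.sgn * r = p.sgn * s ↔ r = s := by
  cases p <;> simp [Player.sgn]

/-! ### Values of discounted normal play games -/

section DNP

variable {n : ℕ} {lam : ℝ} {owner : Fin n → Player} {H K : Fin n → Fin n → Prop} {δ δ' : Fin n → ℝ}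

/-- Multiplication by the sign of the owner turns minima into maxima, so later arguments need no
case distinction on the players. -/
theorem isDNPValue_iff : IsDNPValue lam owner H δ ↔
    ∀ a, (∀ b, H a b → lam * ((owner a).sgn * δ b) ≤ (owner a).sgn * δ a) ∧
      ((∃ b, H a b ∧ δ a = lam * δ b) ∨ ((∀ b, ¬ H a b) ∧ δ a = -(owner a).sgn)) := by
  refine forall_congr' fun a => ?_
  by_cases hs : ∃ b, H a b
  · have hs' : ¬ ∀ b, ¬ H a b := by simpa using hs
    cases ho : owner a
    · simp only [hs, hs', IsGreatest, Player.sgn, upperBounds]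
      simp
      constructor
      · rintro ⟨h1, h2⟩; exact ⟨fun b hb => h2 b hb rfl, h1⟩
      · rintro ⟨h1, h2⟩; exact ⟨h2, fun _ b hb hh => by rw [hh]; exact h1 b hb⟩
    · simp only [hs, hs', IsLeast, Player.sgn, lowerBounds]
      simp
      constructor
      · rintro ⟨h1, h2⟩; exact ⟨fun b hb => h2 b hb rfl, h1⟩
      · rintro ⟨h1, h2⟩; exact ⟨h2, fun _ b hb hh => by rw [hh]; exact h1 b hb⟩
  · have hs' : ∀ b, ¬ H a b := by simpa using hs
    cases ho : owner a <;> simp [hs', Player.sgn]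

/-- This symmetry reduces every statement about negative levels to positive ones. -/
theorem IsDNPValue.neg (h : IsDNPValue lam owner H δ) :
    IsDNPValue lam (fun a => (owner a).swap) H (-δ) := by
  rw [isDNPValue_iff] at *
  intro a
  obtain ⟨h1, h2⟩ := h a
  simp only [Player.sgn_swap, Pi.neg_apply, neg_mul_neg]
  refine ⟨h1, h2.imp ?_ ?_⟩
  · rintro ⟨b, hb, e⟩; exact ⟨b, hb, by rw [e]; ring⟩
  · rintro ⟨hb, e⟩; exact ⟨hb, by rw [e]⟩

theorem IsDNPValue.eq_or (h : IsDNPValue lam owner H δ) (a : Fin n) :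
    (∃ b, H a b ∧ δ a = lam * δ b) ∨ ((∀ b, ¬ H a b) ∧ δ a = -(owner a).sgn) :=
  (isDNPValue_iff.1 h a).2

theorem IsDNPValue.le (h : IsDNPValue lam owner H δ) {a b : Fin n} (hb : H a b) :
    lam * ((owner a).sgn * δ b) ≤ (owner a).sgn * δ a :=
  (isDNPValue_iff.1 h a).1 b hb

/-- Take a counterexample of largest absolute value. It is not a sink, and its optimal successor has
a strictly larger absolute value, so the successor is a power of `lam`, a contradiction. -/
theorem IsDNPValue.exists_abs_eq_pow (h : IsDNPValue lam owner H δ) (h0 : 0 < lam) (h1 : lam < 1)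
    (a : Fin n) (ha : δ a ≠ 0) : ∃ s : ℕ, |δ a| = lam ^ s := by
  by_contra hc
  classical
  let S := Finset.univ.filter fun a => δ a ≠ 0 ∧ ¬ ∃ s : ℕ, |δ a| = lam ^ s
  obtain ⟨c, hcS, hmax⟩ := S.exists_max_image (fun a => |δ a|) ⟨a, by simpa [S, ha] using hc⟩
  simp only [S, Finset.mem_filter, Finset.mem_univ, true_and] at hcS hmax
  rcases h.eq_or c with ⟨b, -, e⟩ | ⟨-, e⟩
  · have hb : δ b ≠ 0 := fun hb => hcS.1 (by rw [e, hb, mul_zero])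
    have hpos : 0 < |δ b| := abs_pos.2 hb
    have e' : |δ c| = lam * |δ b| := by rw [e, abs_mul, abs_of_pos h0]
    by_cases hs : ∃ s : ℕ, |δ b| = lam ^ s
    · obtain ⟨s, hs⟩ := hs
      exact hcS.2 ⟨s + 1, by rw [e', hs]; ring⟩
    · have := hmax b ⟨hb, hs⟩
      nlinarith
  · exact hcS.2 ⟨0, by rw [e, abs_neg, Player.abs_sgn, pow_zero]⟩

theorem IsDNPValue.abs_le_one (h : IsDNPValue lam owner H δ) (h0 : 0 < lam) (h1 : lam < 1)
    (a : Fin n) : |δ a| ≤ 1 := by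
  by_cases ha : δ a = 0
  · simp [ha]
  · obtain ⟨s, hs⟩ := h.exists_abs_eq_pow h0 h1 a ha
    rw [hs]
    exact pow_le_one₀ h0.le h1.le

theorem pow_injective_of_mem_Ioo (h0 : 0 < lam) (h1 : lam < 1) :
    Function.Injective fun s : ℕ => lam ^ s :=
  (pow_right_strictAnti₀ h0 h1).injective

/-- Each optimal move lowers the exponent by one, and a sink, having value `± 1`, cannot be met
before exponent `0`. Hence the occupied levels have no gaps. -/
theorem IsDNPValue.exists_eq_pow_of_le (h : IsDNPValue lam owner H δ) (h0 : 0 < lam) (h1 : lam < 1)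
    {a : Fin n} {s : ℕ} (ha : δ a = lam ^ s) {r : ℕ} (hr : r ≤ s) : ∃ b, δ b = lam ^ r := by
  induction s generalizing a with
  | zero => exact ⟨a, by rw [ha, Nat.le_zero.1 hr]⟩
  | succ s ih =>
    rcases Nat.lt_or_ge s r with hlt | hge
    · exact ⟨a, by rw [ha, show r = s + 1 by omega]⟩
    · rcases h.eq_or a with ⟨b, -, e⟩ | ⟨-, e⟩
      · refine ih (a := b) ?_ hge
        rw [ha, pow_succ', mul_right_inj' h0.ne'] at e
        exact e.symm
      · have := pow_lt_one₀ h0.le h1 (Nat.succ_ne_zero s)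
        have h2 : |δ a| = 1 := by rw [e, abs_neg, Player.abs_sgn]
        rw [ha, abs_of_pos (pow_pos h0 _)] at h2
        exact absurd h2 this.ne

theorem IsDNPValue.lt_of_eq_pow (h : IsDNPValue lam owner H δ) (h0 : 0 < lam) (h1 : lam < 1)
    {a : Fin n} {s : ℕ} (ha : δ a = lam ^ s) : s < n := by
  choose f hf using fun r : Fin (s + 1) =>
    h.exists_eq_pow_of_le h0 h1 ha (Nat.lt_succ_iff.1 r.2)
  have hinj : Function.Injective f := fun r r' hrr => by
    have := (hf r).symm.trans ((congrArg δ hrr).trans (hf r'))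
    exact Fin.ext (pow_injective_of_mem_Ioo h0 h1 this)
  have := Fintype.card_le_of_injective f hinj
  simp at this
  omega

theorem IsDNPValue.trichotomy (h : IsDNPValue lam owner H δ) (h0 : 0 < lam) (h1 : lam < 1)
    (a : Fin n) : δ a = 0 ∨ ∃ s < n, δ a = lam ^ s ∨ δ a = -lam ^ s := by
  by_cases ha : δ a = 0
  · exact Or.inl ha
  · obtain ⟨s, hs⟩ := h.exists_abs_eq_pow h0 h1 a ha
    rcases abs_choice (δ a) with e | e
    · rw [e] at hs
      exact Or.inr ⟨s, h.lt_of_eq_pow h0 h1 hs, Or.inl hs⟩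
    · rw [e] at hs
      exact Or.inr ⟨s, h.neg.lt_of_eq_pow h0 h1 (a := a) hs, Or.inr (by rw [← hs, neg_neg])⟩

/-- Banach's fixed point theorem for the operator in which every node, sink or not, also has the
option of losing at once. At the fixed point all values lie in `[-1, 1]`, so any genuine move gives
its owner at least `-lam > -1` and the extra option is never optimal at a non-sink. -/
theorem exists_isDNPValue (owner : Fin n → Player) (H : Fin n → Fin n → Prop) (h0 : 0 < lam)
    (h1 : lam < 1) : ∃ δ, IsDNPValue lam owner H δ := by
  classical
  let S : (Fin n → ℝ) → Fin n → Finset ℝ := fun u a =>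
    insert (-1) ((Finset.univ.filter (H a)).image fun b => lam * ((owner a).sgn * u b))
  have hS : ∀ u a, (S u a).Nonempty := fun u a => Finset.insert_nonempty _ _
  let F : (Fin n → ℝ) → Fin n → ℝ := fun u a => (owner a).sgn * (S u a).max' (hS u a)
  have hF : ∀ u a, (owner a).sgn * F u a = (S u a).max' (hS u a) := fun u a =>
    Player.sgn_mul_sgn_mul _ _
  have hFge : ∀ u a, -1 ≤ (owner a).sgn * F u a := fun u a => by
    rw [hF]; exact Finset.le_max' _ _ (by simp [S])
  have hFge' : ∀ u a b, H a b → lam * ((owner a).sgn * u b) ≤ (owner a).sgn * F u a :=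
    fun u a b hb => by
      rw [hF]
      refine Finset.le_max' _ _ ?_
      simp only [S, Finset.mem_insert, Finset.mem_image, Finset.mem_filter]
      exact Or.inr ⟨b, ⟨Finset.mem_univ _, hb⟩, rfl⟩
  have hFeq : ∀ u a, (owner a).sgn * F u a = -1 ∨
      ∃ b, H a b ∧ (owner a).sgn * F u a = lam * ((owner a).sgn * u b) := fun u a => by
    have := (S u a).max'_mem (hS u a)
    rw [← hF] at this
    simp only [S, Finset.mem_insert, Finset.mem_image, Finset.mem_filter] at this
    rcases this with h | ⟨b, ⟨-, hb⟩, e⟩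
    · exact Or.inl h
    · exact Or.inr ⟨b, hb, e.symm⟩
  clear_value F
  have key : ∀ u v a, (owner a).sgn * F u a ≤ (owner a).sgn * F v a + lam * dist u v := by
    intro u v a
    have hd : 0 ≤ lam * dist u v := mul_nonneg h0.le dist_nonneg
    rcases hFeq u a with e | ⟨b, hb, e⟩
    · linarith [hFge v a]
    · have h3 := hFge' v a b hb
      have h4 : (owner a).sgn * u b - (owner a).sgn * v b ≤ dist u v := by
        refine le_trans (le_abs_self _) ?_
        rw [← mul_sub, abs_mul, Player.abs_sgn, one_mul, ← Real.dist_eq]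
        exact dist_le_pi_dist u v b
      nlinarith
  have hlip : LipschitzWith ⟨lam, h0.le⟩ F := by
    refine LipschitzWith.of_dist_le_mul fun u v => ?_
    refine (dist_pi_le_iff (mul_nonneg h0.le dist_nonneg)).2 fun a => ?_
    have h3 := key u v a
    have h4 := key v u a
    rw [dist_comm v u] at h4
    rw [Real.dist_eq]
    have : |F u a - F v a| = |(owner a).sgn * F u a - (owner a).sgn * F v a| := by
      rw [← mul_sub, abs_mul, Player.abs_sgn, one_mul]
    rw [this, abs_le]
    change _ ≤ _ ∧ _ ≤ lam * dist u v
    change -(lam * dist u v) ≤ _ ∧ _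
    constructor <;> linarith
  have hcon : ContractingWith ⟨lam, h0.le⟩ F := ⟨by exact_mod_cast h1, hlip⟩
  have hfix := hcon.fixedPoint_isFixedPt
  set δ := ContractingWith.fixedPoint F hcon
  have hfix : F δ = δ := hfix
  have hnorm : ∀ a, |δ a| ≤ 1 := by
    intro a
    have : Nonempty (Fin n) := ⟨a⟩
    obtain ⟨c, hc⟩ := Finite.exists_max fun a => |δ a|
    refine (hc a).trans ?_
    have h3 := hFeq δ c
    rw [hfix] at h3
    have h5 : |(owner c).sgn * δ c| = |δ c| := by rw [abs_mul, Player.abs_sgn, one_mul]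
    rcases h3 with e | ⟨b, -, e⟩
    · rw [← h5, e]; simp
    · rw [e, abs_mul, abs_mul, Player.abs_sgn, one_mul, abs_of_pos h0] at h5
      have := hc b
      nlinarith [abs_nonneg (δ c)]
  refine ⟨δ, isDNPValue_iff.2 fun a => ?_⟩
  have h2 := hFge' δ a
  have h3 := hFeq δ a
  rw [hfix] at h2 h3
  refine ⟨h2, ?_⟩
  by_cases hs : ∃ b, H a b
  · left
    rcases h3 with e | ⟨b, hb, e⟩
    · exfalso
      obtain ⟨b, hb⟩ := hs
      have h4 := h2 b hb
      have h5 : |(owner a).sgn * δ b| ≤ 1 := by rw [abs_mul, Player.abs_sgn, one_mul]; exact hnorm b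
      rw [e] at h4
      nlinarith [(abs_le.1 h5).1]
    · refine ⟨b, hb, (owner a).sgn_mul_inj.1 ?_⟩
      rw [e]; ring
  · right
    rcases h3 with e | ⟨b, hb, -⟩
    · refine ⟨by simpa using hs, (owner a).sgn_mul_inj.1 ?_⟩
      rw [e, mul_neg, Player.sgn_mul_self]
    · exact absurd ⟨b, hb⟩ hs

end DNP

/-! ### Monotonicity of level profiles under a step of DNP games iteration. -/

section DNPIteration

variable {n : ℕ} {lam : ℝ} {owner : Fin n → Player} {H K : Fin n → Fin n → Prop} {δ δ' : Fin n → ℝ}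

/-- At a node where the difference is largest, the hypothesis bounds it by `lam` times itself. This
gives uniqueness both for DNP values and for the optimality equations. -/
theorem eq_of_forall_exists_abs_sub_le (h1 : lam < 1)
    (h : ∀ a, ∃ b, |δ a - δ' a| ≤ lam * |δ b - δ' b|) (h0 : 0 < lam) : δ = δ' := by
  funext a
  have : Nonempty (Fin n) := ⟨a⟩
  obtain ⟨c, hc⟩ := Finite.exists_max fun a => |δ a - δ' a|
  obtain ⟨b, hb⟩ := h c
  have h2 : |δ c - δ' c| ≤ 0 := by
    have := hc b
    nlinarith [abs_nonneg (δ c - δ' c)]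
  have := (hc a).trans h2
  exact sub_eq_zero.1 (abs_nonpos_iff.1 this)

theorem IsDNPValue.unique (h : IsDNPValue lam owner H δ) (h' : IsDNPValue lam owner H δ')
    (h0 : 0 < lam) (h1 : lam < 1) : δ = δ' := by
  have key : ∀ {δ δ' : Fin n → ℝ}, IsDNPValue lam owner H δ → IsDNPValue lam owner H δ' →
      ∀ a, ∃ b, (owner a).sgn * δ a - (owner a).sgn * δ' a ≤ lam * |δ b - δ' b| := by
    intro δ δ' h h' a
    rcases h.eq_or a with ⟨b, hb, e⟩ | ⟨hb, e⟩
    · refine ⟨b, ?_⟩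
      have h2 := h'.le hb
      have h3 := le_abs_self ((owner a).sgn * (δ b - δ' b))
      rw [abs_mul, Player.abs_sgn, one_mul] at h3
      rw [e]
      nlinarith
    · rcases h'.eq_or a with ⟨b, hb', -⟩ | ⟨-, e'⟩
      · exact absurd hb' (hb b)
      · refine ⟨a, ?_⟩
        rw [e, e']; simp
  refine eq_of_forall_exists_abs_sub_le h1 (fun a => ?_) h0
  have h3 : |δ a - δ' a| = |(owner a).sgn * δ a - (owner a).sgn * δ' a| := by
    rw [← mul_sub, abs_mul, Player.abs_sgn, one_mul]
  rw [h3]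
  rcases abs_choice ((owner a).sgn * δ a - (owner a).sgn * δ' a) with e | e
  · rw [e]; exact key h h' a
  · rw [e]
    obtain ⟨b, hb⟩ := key h' h a
    exact ⟨b, by rw [abs_sub_comm]; linarith⟩

/-- The numbers of nodes of Max and of Min with value `lam ^ s`, for `s = 0, …, n - 1`. -/
noncomputable def levelProfile (lam : ℝ) (owner : Fin n → Player) (δ : Fin n → ℝ) :
    Fin n → ℕ × ℕ := by
  classical exact fun s =>
    ((Finset.univ.filter fun a => owner a = Player.max ∧ δ a = lam ^ (s : ℕ)).card,
     (Finset.univ.filter fun a => owner a = Player.min ∧ δ a = lam ^ (s : ℕ)).card)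

/-- Lexicographic order on level profiles, with more nodes of Max and fewer nodes of Min being larger. -/
def profileKey (g : Fin n → ℕ × ℕ) : Lex (Fin n → ℕ ×ₗ ℕᵒᵈ) :=
  toLex fun s => toLex ((g s).1, OrderDual.toDual (g s).2)

/-- A Max node on level `s` keeps its optimal edge to level `s - 1`, which has not changed, so it
still secures `lam ^ s`; it cannot do better, because the levels above agree. A Min node not on
level `s` that entered it would have had a smaller value before; its optimal edge then led below
level `s - 1`, is still present and still leads there, so Min would still get less than `lam ^ s`.
-/
theorem IsDNPValue.level_subset (h : IsDNPValue lam owner H δ) (h' : IsDNPValue lam owner K δ')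
    (h0 : 0 < lam) (h1 : lam < 1) (hopt : ∀ a b, H a b → δ a = lam * δ b → K a b) {s : ℕ}
    (hs : ∀ r < s, ∀ a, δ a = lam ^ r ↔ δ' a = lam ^ r) (a : Fin n) :
    (owner a = Player.max → δ a = lam ^ s → δ' a = lam ^ s) ∧
      (owner a = Player.min → δ' a = lam ^ s → δ a = lam ^ s) := by
  have val : ∀ {d : Fin n → ℝ} {L : Fin n → Fin n → Prop} (c : Fin n) (s : ℕ),
      IsDNPValue lam owner L d → lam ^ s ≤ d c → ∃ r ≤ s, d c = lam ^ r := by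
    intro d L c s hd hc
    rcases hd.trichotomy h0 h1 c with e | ⟨r, -, e | e⟩
    · exact absurd (pow_pos h0 s) (by linarith)
    · refine ⟨r, ?_, e⟩
      rw [e] at hc
      exact (pow_right_strictAnti₀ h0 h1).le_iff_ge.1 hc
    · exact absurd (pow_pos h0 s) (by have := pow_pos h0 r; linarith)
  refine ⟨fun ho e => ?_, fun ho e => ?_⟩
  · rcases h.eq_or a with ⟨b, hb, hab⟩ | ⟨-, e'⟩
    · have hK := h'.le (hopt a b hb hab)
      simp only [ho, Player.sgn, one_mul] at hK
      -- Level `0` holds no Max node with a move: after a move the value is at most `lam`.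
      rcases s with _ | s
      · have hb1 := (abs_le.1 (h.abs_le_one h0 h1 b)).2
        rw [pow_zero] at e
        nlinarith
      · rw [e, pow_succ', mul_right_inj' h0.ne'] at hab
        rw [(hs s (Nat.lt_succ_self s) b).1 hab.symm, ← pow_succ'] at hK
        obtain ⟨r, hr, er⟩ := val a _ h' hK
        rcases hr.lt_or_eq with hlt | rfl
        · have := (hs r hlt a).2 er
          rw [e] at this
          rw [er, this]
        · exact er
    · rw [ho, e] at e'
      simp only [Player.sgn] at e'
      linarith [pow_pos h0 s]
  · by_contra hne
    -- A value of at least `lam ^ s` would be on a level `r ≤ s`; `r < s` is excluded because those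
    -- levels agree, and `r = s` by assumption.
    have hlt : δ a < lam ^ s := by
      by_contra hge
      obtain ⟨r, hr, er⟩ := val a s h (not_lt.1 hge)
      rcases hr.lt_or_eq with hlt | rfl
      · have h2 := (hs r hlt a).1 er
        rw [e] at h2
        exact hne (by rw [er, h2])
      · exact hne er
    rcases h.eq_or a with ⟨b, hb, hab⟩ | ⟨-, e'⟩
    · have hK := h'.le (hopt a b hb hab)
      simp only [ho, Player.sgn] at hK
      have hK' : lam ^ s ≤ lam * δ' b := by linarith
      rcases s with _ | s
      · have hb1 := (abs_le.1 (h'.abs_le_one h0 h1 b)).2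
        rw [pow_zero] at hK'
        nlinarith
      · rw [pow_succ'] at hK' hlt
        have h2 : lam ^ s ≤ δ' b := le_of_mul_le_mul_left hK' h0
        obtain ⟨r, hr, er⟩ := val b s h' h2
        rw [hab] at hlt
        have h3 : δ b < lam ^ s := lt_of_mul_lt_mul_left hlt h0.le
        rw [(hs r (by omega) b).2 er, ← er] at h3
        linarith
    · rw [ho] at e'
      simp only [Player.sgn, neg_neg] at e'
      have := pow_le_one₀ h0.le h1.le (n := s)
      linarith

/-- At the first level that differs, the set of Max nodes grows and that of Min nodes shrinks, and
one inclusion is strict. Nothing is known about later levels, but the lexicographic order ignores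
them. -/
theorem IsDNPValue.profileKey_le (h : IsDNPValue lam owner H δ) (h' : IsDNPValue lam owner K δ')
    (h0 : 0 < lam) (h1 : lam < 1) (hopt : ∀ a b, H a b → δ a = lam * δ b → K a b) :
    profileKey (levelProfile lam owner δ) ≤ profileKey (levelProfile lam owner δ') ∧
      ((∃ s a, ¬ (δ a = lam ^ s ↔ δ' a = lam ^ s)) →
        profileKey (levelProfile lam owner δ) < profileKey (levelProfile lam owner δ')) := by
  classical
  by_cases hex : ∃ s, ∃ a, ¬ (δ a = lam ^ s ↔ δ' a = lam ^ s)
  · refine (fun hlt => ⟨le_of_lt hlt, fun _ => hlt⟩) ?_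
    obtain ⟨a, ha⟩ := Nat.find_spec hex
    have hmin : ∀ r < Nat.find hex, ∀ a, δ a = lam ^ r ↔ δ' a = lam ^ r := fun r hr a => by
      have := Nat.find_min hex hr
      push Not at this
      have := this a
      tauto
    generalize Nat.find hex = s at ha hmin
    have hsn : s < n := by
      by_contra hge
      refine ha ⟨fun e => ?_, fun e => ?_⟩
      · exact absurd (h.lt_of_eq_pow h0 h1 e) hge
      · exact absurd (h'.lt_of_eq_pow h0 h1 e) hge
    have hsub := h.level_subset h' h0 h1 hopt hmin
    refine ⟨⟨s, hsn⟩, fun r hr => ?_, ?_⟩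
    · have hr' : (r : ℕ) < s := hr
      simp only [profileKey, levelProfile, Pi.toLex_apply, hmin r hr']
    · simp only [profileKey, Pi.toLex_apply, levelProfile]
      rw [Prod.Lex.toLex_lt_toLex]
      have hP : (Finset.univ.filter fun a => owner a = Player.max ∧ δ a = lam ^ s) ⊆
          Finset.univ.filter fun a => owner a = Player.max ∧ δ' a = lam ^ s := fun a => by
        simp only [Finset.mem_filter, Finset.mem_univ, true_and]
        exact fun ⟨ho, e⟩ => ⟨ho, (hsub a).1 ho e⟩
      have hQ : (Finset.univ.filter fun a => owner a = Player.min ∧ δ' a = lam ^ s) ⊆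
          Finset.univ.filter fun a => owner a = Player.min ∧ δ a = lam ^ s := fun a => by
        simp only [Finset.mem_filter, Finset.mem_univ, true_and]
        exact fun ⟨ho, e⟩ => ⟨ho, (hsub a).2 ho e⟩
      rcases (Finset.card_le_card hP).lt_or_eq with hlt | heq
      · exact Or.inl hlt
      · refine Or.inr ⟨heq, OrderDual.toDual_lt_toDual.2 ((Finset.card_le_card hQ).lt_of_ne ?_)⟩
        intro heq'
        have hP' := Finset.eq_of_subset_of_card_le hP heq.ge
        have hQ' := Finset.eq_of_subset_of_card_le hQ heq'.ge
        have hPa := congrArg (a ∈ ·) hP'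
        have hQa := congrArg (a ∈ ·) hQ'
        simp only [Finset.mem_filter, Finset.mem_univ, true_and, eq_iff_iff] at hPa hQa
        cases ho : owner a
        · exact ha (by simpa [ho] using hPa)
        · exact ha (by simpa [ho] using hQa.symm)
  · refine ⟨le_of_eq ?_, fun hx => absurd hx hex⟩
    push Not at hex
    have : ∀ s a, δ a = lam ^ s ↔ δ' a = lam ^ s := fun s a => by have := hex s a; tauto
    unfold levelProfile
    simp only [this]

theorem IsDNPValue.eq_of_levels (h : IsDNPValue lam owner H δ) (h' : IsDNPValue lam owner K δ')
    (h0 : 0 < lam) (h1 : lam < 1) (hpos : ∀ s a, δ a = lam ^ s ↔ δ' a = lam ^ s)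
    (hneg : ∀ s a, (-δ) a = lam ^ s ↔ (-δ') a = lam ^ s) : δ = δ' := by
  funext a
  simp only [Pi.neg_apply] at hneg
  rcases h.trichotomy h0 h1 a with e | ⟨s, -, e | e⟩
  · rcases h'.trichotomy h0 h1 a with e' | ⟨s, -, e' | e'⟩
    · rw [e, e']
    · rw [e', (hpos s a).2 e']
    · have := (hneg s a).2 (by rw [e', neg_neg])
      rw [e', ← this, neg_neg]
  · rw [e, (hpos s a).1 e]
  · have := (hneg s a).1 (by rw [e, neg_neg])
    rw [e, ← this, neg_neg]

/-- If no level of either sign changed, both graphs would have the same values, and the violating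
pair contained in `K` would contradict their optimality in `K`. -/
theorem DNPStep.profileKey_lt (h0 : 0 < lam) (h1 : lam < 1) (hst : DNPStep lam owner H K)
    (h : IsDNPValue lam owner H δ) (h' : IsDNPValue lam owner K δ') :
    let pos := fun d => profileKey (levelProfile lam owner d)
    let neg := fun d => profileKey (levelProfile lam (fun a => (owner a).swap) (-d))
    (pos δ < pos δ' ∧ neg δ ≤ neg δ') ∨ (pos δ ≤ pos δ' ∧ neg δ < neg δ') := by
  obtain ⟨d, hd, hopt, a, b, hab, hviol⟩ := hst
  obtain rfl := hd.unique h h0 h1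
  have hp := h.profileKey_le h' h0 h1 hopt
  have hn := h.neg.profileKey_le h'.neg h0 h1 (fun a b hab e => hopt a b hab (by
    simp only [Pi.neg_apply] at e; linarith))
  by_cases hpe : ∃ s a, ¬ (d a = lam ^ s ↔ δ' a = lam ^ s)
  · exact Or.inl ⟨hp.2 hpe, hn.1⟩
  by_cases hne : ∃ s a, ¬ ((-d) a = lam ^ s ↔ (-δ') a = lam ^ s)
  · exact Or.inr ⟨hp.1, hn.2 hne⟩
  exfalso
  push Not at hpe hne
  obtain rfl := h.eq_of_levels h' h0 h1 (fun s a => by have := hpe s a; tauto)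
    (fun s a => by have := hne s a; tauto)
  have := h'.le hab
  rcases hviol with ⟨ho, hlt⟩ | ⟨ho, hlt⟩ <;> rw [ho] at this <;> simp only [Player.sgn] at this <;>
    linarith

/-! ### Counting level profiles -/

/-- The pairs of numbers of nodes that may occur on level `s` if the nonempty levels are
those below `l`. -/
def levelPairs (n l s : ℕ) : Finset (ℕ × ℕ) :=
  if s < l then (Finset.range (n + 1) ×ˢ Finset.range (n + 1)).erase (0, 0) else {(0, 0)}

/-- The parameter `l` is the number of nonempty levels. Requiring them to be exactly the first `l`
is what makes the count small enough. -/
def allProfiles (n : ℕ) : Finset (Fin n → ℕ × ℕ) :=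
  ((Finset.range (n + 1)).biUnion fun l => Fintype.piFinset fun s : Fin n => levelPairs n l s).filter
    fun g => ∑ s, ((g s).1 + (g s).2) ≤ n

/-- The sum over all pairs is the square of a geometric sum, at most `1 / (1 - x) ^ 2 = 2`; omitting
`(0, 0)` removes `1`. -/
theorem sum_levelPairs_le (n l s : ℕ) {x : ℝ} (hx0 : 0 < x) (hx : 2 * (1 - x) ^ 2 = 1) (hx1 : x < 1) :
    ∑ p ∈ levelPairs n l s, x ^ (p.1 + p.2) ≤ 1 := by
  unfold levelPairs
  split_ifs
  · have h2 : ∑ p ∈ Finset.range (n + 1) ×ˢ Finset.range (n + 1), x ^ (p.1 + p.2) =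
        (∑ i ∈ Finset.range (n + 1), x ^ i) ^ 2 := by
      rw [sq, Finset.sum_mul_sum, Finset.sum_product]
      simp only [pow_add]
    have h3 := Finset.add_sum_erase (Finset.range (n + 1) ×ˢ Finset.range (n + 1))
      (fun p => x ^ (p.1 + p.2)) (a := (0, 0)) (by simp)
    have h4 : (∑ i ∈ Finset.range (n + 1), x ^ i) * (1 - x) ≤ 1 := by
      rw [geom_sum_mul_neg]
      linarith [pow_pos hx0 (n + 1)]
    have h5 : 0 ≤ (∑ i ∈ Finset.range (n + 1), x ^ i) * (1 - x) :=
      mul_nonneg (Finset.sum_nonneg fun i _ => (pow_pos hx0 i).le) (by linarith)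
    rw [h2] at h3
    simp only [add_zero, pow_zero] at h3
    have h6 : ((∑ i ∈ Finset.range (n + 1), x ^ i) * (1 - x)) ^ 2 ≤ 1 := pow_le_one₀ h5 h4
    rw [mul_pow] at h6
    nlinarith
  · simp

theorem sum_biUnion_le_sum {α β : Type*} [DecidableEq α] [DecidableEq β] (s : Finset α)
    (t : α → Finset β) {f : β → ℝ} (hf : ∀ b, 0 ≤ f b) :
    ∑ b ∈ s.biUnion t, f b ≤ ∑ a ∈ s, ∑ b ∈ t a, f b := by
  induction s using Finset.induction_on with
  | empty => simp
  | insert a s ha ih =>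
    rw [Finset.biUnion_insert, Finset.sum_insert ha]
    have := Finset.sum_union_inter (s₁ := t a) (s₂ := s.biUnion t) (f := f)
    linarith [Finset.sum_nonneg fun b (_ : b ∈ t a ∩ s.biUnion t) => hf b]

/-- Give a profile the weight `x` to the number of its nodes, which is at least `x ^ n`. For each
`l` the total weight factors over the levels and is at most `1`, and `l` takes `n + 1` values. -/
theorem card_allProfiles_le (n : ℕ) : ((allProfiles n).card : ℝ) ≤ (n + 1) * (2 + √2) ^ n := by
  have hs : √2 * √2 = 2 := Real.mul_self_sqrt (by norm_num)
  have hs0 : 0 ≤ √2 := Real.sqrt_nonneg 2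
  have hs1 : √2 < 2 := by nlinarith
  have hs2 : 0 < √2 := Real.sqrt_pos.2 (by norm_num)
  -- This is `1 / (2 + √2)`, the root in `(0, 1)` of `1 / (1 - x) ^ 2 - 1 = 1`.
  obtain ⟨x, hx⟩ : ∃ x : ℝ, x = 1 - √2 / 2 := ⟨_, rfl⟩
  have hx0 : 0 < x := by rw [hx]; linarith
  have hx1 : x < 1 := by rw [hx]; linarith
  have hxr : x * (2 + √2) = 1 := by rw [hx]; nlinarith
  have hxx : 2 * (1 - x) ^ 2 = 1 := by rw [hx]; nlinarith
  have h1 : ∀ l, ∑ g ∈ Fintype.piFinset fun s : Fin n => levelPairs n l s,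
      ∏ s, x ^ ((g s).1 + (g s).2) ≤ 1 := fun l => by
    rw [← Finset.prod_univ_sum (fun s : Fin n => levelPairs n l s) (fun _ p => x ^ (p.1 + p.2))]
    exact Finset.prod_le_one (fun s _ => Finset.sum_nonneg fun p _ => (pow_pos hx0 _).le)
      fun s _ => sum_levelPairs_le n l s hx0 hxx hx1
  have h2 : ∑ g ∈ allProfiles n, x ^ n ≤ n + 1 := by
    calc ∑ g ∈ allProfiles n, x ^ n
        ≤ ∑ g ∈ allProfiles n, ∏ s, x ^ ((g s).1 + (g s).2) := by
          refine Finset.sum_le_sum fun g hg => ?_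
          rw [Finset.prod_pow_eq_pow_sum]
          exact pow_le_pow_of_le_one hx0.le hx1.le (Finset.mem_filter.1 hg).2
      _ ≤ ∑ g ∈ (Finset.range (n + 1)).biUnion
            fun l => Fintype.piFinset fun s : Fin n => levelPairs n l s,
            ∏ s, x ^ ((g s).1 + (g s).2) :=
          Finset.sum_le_sum_of_subset_of_nonneg (Finset.filter_subset _ _)
            fun g _ _ => Finset.prod_nonneg fun s _ => (pow_pos hx0 _).le
      _ ≤ ∑ l ∈ Finset.range (n + 1), ∑ g ∈ Fintype.piFinset fun s : Fin n => levelPairs n l s,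
            ∏ s, x ^ ((g s).1 + (g s).2) :=
          sum_biUnion_le_sum _ _ fun g => Finset.prod_nonneg fun s _ => (pow_pos hx0 _).le
      _ ≤ ∑ l ∈ Finset.range (n + 1), 1 := Finset.sum_le_sum fun l _ => h1 l
      _ = n + 1 := by simp
  rw [Finset.sum_const, nsmul_eq_mul] at h2
  have h3 : (x * (2 + √2)) ^ n = 1 := by rw [hxr, one_pow]
  rw [mul_pow] at h3
  have h4 : 0 ≤ (2 + √2) ^ n := by positivity
  calc ((allProfiles n).card : ℝ) = (allProfiles n).card * x ^ n * (2 + √2) ^ n := by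
        rw [mul_assoc, h3, mul_one]
    _ ≤ _ := mul_le_mul_of_nonneg_right h2 h4

/-- Take for `l` the first empty level; since levels have no gaps, all later ones are empty too. -/
theorem IsDNPValue.levelProfile_mem (h : IsDNPValue lam owner H δ) (h0 : 0 < lam) (h1 : lam < 1) :
    levelProfile lam owner δ ∈ allProfiles n := by
  classical
  have hcard : ∀ p s, (Finset.univ.filter fun a => owner a = p ∧ δ a = lam ^ s).card ≤ n :=
    fun p s => (Finset.card_le_univ _).trans (by simp)
  have hne : ∀ s : Fin n, levelProfile lam owner δ s ≠ (0, 0) ↔ ∃ a, δ a = lam ^ (s : ℕ) := by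
    intro s
    simp only [levelProfile, ne_eq, Prod.mk.injEq, Finset.card_eq_zero,
      Finset.filter_eq_empty_iff, not_and_or, not_forall]
    constructor
    · rintro (⟨a, ha⟩ | ⟨a, ha⟩) <;> exact ⟨a, by tauto⟩
    · rintro ⟨a, ha⟩
      cases ho : owner a
      · exact Or.inl ⟨a, by simp [ho, ha]⟩
      · exact Or.inr ⟨a, by simp [ho, ha]⟩
  refine Finset.mem_filter.2 ⟨?_, ?_⟩
  · have hex : ∃ l, ∀ a, δ a ≠ lam ^ l :=
      ⟨n, fun a e => lt_irrefl n (h.lt_of_eq_pow h0 h1 e)⟩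
    have hle : Nat.find hex ≤ n :=
      Nat.find_min' hex fun a e => lt_irrefl n (h.lt_of_eq_pow h0 h1 e)
    refine Finset.mem_biUnion.2 ⟨Nat.find hex, Finset.mem_range.2 (by omega), ?_⟩
    refine Fintype.mem_piFinset.2 fun s => ?_
    unfold levelPairs
    split_ifs with hs
    · have := Nat.find_min hex hs
      push Not at this
      refine Finset.mem_erase.2 ⟨(hne s).2 this, Finset.mem_product.2
        ⟨Finset.mem_range.2 (Nat.lt_succ_of_le ?_), Finset.mem_range.2 (Nat.lt_succ_of_le ?_)⟩⟩
      · exact le_of_eq_of_le (by simp [levelProfile]) (hcard Player.max s)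
      · exact le_of_eq_of_le (by simp [levelProfile]) (hcard Player.min s)
    · rw [Finset.mem_singleton]
      by_contra hc
      obtain ⟨a, ha⟩ := (hne s).1 hc
      obtain ⟨b, hb⟩ := h.exists_eq_pow_of_le h0 h1 ha (not_lt.1 hs)
      exact Nat.find_spec hex b hb
  · have h2 : ∀ s : Fin n, (levelProfile lam owner δ s).1 + (levelProfile lam owner δ s).2 =
        (Finset.univ.filter fun a => δ a = lam ^ (s : ℕ)).card := by
      intro s
      simp only [levelProfile]
      rw [← Finset.card_union_of_disjoint]
      · congr 1
        ext a
        simp only [Finset.mem_union, Finset.mem_filter, Finset.mem_univ, true_and]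
        cases owner a <;> simp
      · refine Finset.disjoint_left.2 fun a ha hb => ?_
        simp only [Finset.mem_filter, Finset.mem_univ, true_and] at ha hb
        rw [ha.1] at hb
        exact Player.noConfusion hb.1
    simp only [h2]
    rw [← Finset.card_biUnion]
    · exact (Finset.card_le_univ _).trans (by simp)
    · intro r _ s _ hrs
      refine Finset.disjoint_left.2 fun a ha hb => hrs ?_
      simp only [Finset.mem_filter, Finset.mem_univ, true_and] at ha hb
      exact Fin.ext (pow_injective_of_mem_Ioo h0 h1 (ha.symm.trans hb))

/-- The sum of the ranks of the positive and the negative profile grows with every step, and each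
rank is below the number of profiles. -/
theorem DNPStep.chain_le (hn : 0 < n) (h0 : 0 < lam) (h1 : lam < 1)
    (H : ℕ → Fin n → Fin n → Prop) (j : ℕ) (hH : ∀ i < j, DNPStep lam owner (H i) (H (i + 1))) :
    ((j : ℝ) + 1) ≤ 4 * n * (2 + √2) ^ n := by
  classical
  choose δ hδ using fun i => exists_isDNPValue owner (H i) h0 h1
  set U := (allProfiles n).image profileKey
  let rank : Lex (Fin n → ℕ ×ₗ ℕᵒᵈ) → ℕ := fun y => (U.filter (· < y)).card
  have rank_mono : ∀ y z, y ≤ z → rank y ≤ rank z := fun y z hyz =>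
    Finset.card_le_card fun w => by
      simp only [Finset.mem_filter]
      exact fun hw => ⟨hw.1, hw.2.trans_le hyz⟩
  have rank_strict : ∀ y z, y ∈ U → y < z → rank y < rank z := fun y z hy hyz => by
    refine Finset.card_lt_card ⟨fun w => ?_, fun hsub => ?_⟩
    · simp only [Finset.mem_filter]
      exact fun hw => ⟨hw.1, hw.2.trans hyz⟩
    · have := hsub (Finset.mem_filter.2 ⟨hy, hyz⟩)
      exact lt_irrefl y (Finset.mem_filter.1 this).2
  have rank_lt : ∀ y ∈ U, rank y < U.card := fun y hy =>
    Finset.card_lt_card ⟨Finset.filter_subset _ _, fun hsub =>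
      lt_irrefl y (Finset.mem_filter.1 (hsub hy)).2⟩
  let pos := fun i => profileKey (levelProfile lam owner (δ i))
  let neg := fun i => profileKey (levelProfile lam (fun a => (owner a).swap) (-δ i))
  have hpos : ∀ i, pos i ∈ U := fun i => Finset.mem_image_of_mem _ ((hδ i).levelProfile_mem h0 h1)
  have hneg : ∀ i, neg i ∈ U :=
    fun i => Finset.mem_image_of_mem _ ((hδ i).neg.levelProfile_mem h0 h1)
  have hi : ∀ i ≤ j, i ≤ rank (pos i) + rank (neg i) := by
    intro i
    induction i with
    | zero => intro _; exact Nat.zero_le _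
    | succ i ih =>
      intro hij
      have := ih (by omega)
      rcases (hH i (by omega)).profileKey_lt h0 h1 (hδ i) (hδ (i + 1)) with ⟨hp, hq⟩ | ⟨hp, hq⟩
      · have h2 : rank (pos i) < rank (pos (i + 1)) := rank_strict _ _ (hpos i) hp
        have h3 : rank (neg i) ≤ rank (neg (i + 1)) := rank_mono _ _ hq
        omega
      · have h2 : rank (pos i) ≤ rank (pos (i + 1)) := rank_mono _ _ hp
        have h3 : rank (neg i) < rank (neg (i + 1)) := rank_strict _ _ (hneg i) hq
        omega
  have hj : j + 1 ≤ 2 * (allProfiles n).card := by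
    have h2 := hi j le_rfl
    have h3 := rank_lt _ (hpos j)
    have h4 := rank_lt _ (hneg j)
    have h5 : U.card ≤ (allProfiles n).card := Finset.card_image_le
    omega
  have hj' : (j : ℝ) + 1 ≤ 2 * (allProfiles n).card := by exact_mod_cast hj
  have h2 := card_allProfiles_le n
  have h3 : 0 ≤ (2 + √2) ^ n := by positivity
  -- The constant `4` comes from `2 * (n + 1) ≤ 4 * n`.
  have h4 : (1 : ℝ) ≤ n := by exact_mod_cast hn
  nlinarith

end DNPIteration

/-! ### Polyhedral value iteration -/

namespace DiscountedGame

variable {n : ℕ} {G : DiscountedGame n} {x x' δ : Fin n → ℝ} {ε : ℝ}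

/-- The slack of the constraint of the pair `(a, b)` at `x`. -/
def slack (G : DiscountedGame n) (x : Fin n → ℝ) (a b : Fin n) : ℝ :=
  (G.owner a).sgn * (x a - G.w a b - G.lam * x b)

/-- The rate at which the slack decreases in the direction `δ`. -/
def rate (G : DiscountedGame n) (δ : Fin n → ℝ) (a b : Fin n) : ℝ :=
  (G.owner a).sgn * (G.lam * δ b - δ a)

theorem mem_optPol_iff : x ∈ G.optPol ↔ ∀ a b, G.E a b → 0 ≤ G.slack x a b := by
  refine forall_congr' fun a => forall_congr' fun b => imp_congr_right fun _ => ?_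
  unfold slack
  cases G.owner a <;> simp [Player.sgn] <;> constructor <;> intro h <;> linarith

theorem slack_eq_zero_iff {a b : Fin n} :
    G.slack x a b = 0 ↔ x a = G.w a b + G.lam * x b := by
  unfold slack
  cases G.owner a <;> simp only [Player.sgn] <;> constructor <;> intro h <;> linarith

theorem tight_iff {a b : Fin n} : G.tight x a b ↔ G.E a b ∧ G.slack x a b = 0 := by
  rw [slack_eq_zero_iff, tight]

theorem slack_add (a b : Fin n) :
    G.slack (x + ε • δ) a b = G.slack x a b - ε * G.rate δ a b := by
  simp only [slack, rate, Pi.add_apply, Pi.smul_apply, smul_eq_mul]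
  ring

theorem rate_pos_iff {a b : Fin n} : 0 < G.rate δ a b ↔
    (G.owner a = Player.max ∧ δ a < G.lam * δ b) ∨
      (G.owner a = Player.min ∧ G.lam * δ b < δ a) := by
  unfold rate
  cases G.owner a <;> simp [Player.sgn]

theorem rate_eq_zero_iff {a b : Fin n} : G.rate δ a b = 0 ↔ δ a = G.lam * δ b := by
  unfold rate
  cases G.owner a <;> simp only [Player.sgn] <;> constructor <;> intro h <;> linarith

theorem OptimalityEquations.mem_optPol (h : G.OptimalityEquations x) : x ∈ G.optPol :=
  fun a b hab => ⟨fun ho => (h.1 a ho).2 ⟨b, hab, rfl⟩, fun ho => (h.2 a ho).2 ⟨b, hab, rfl⟩⟩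

theorem OptimalityEquations.exists_tight (h : G.OptimalityEquations x) (a : Fin n) :
    ∃ b, G.tight x a b := by
  cases ho : G.owner a
  · obtain ⟨b, hb, e⟩ := (h.1 a ho).1
    exact ⟨b, hb, e⟩
  · obtain ⟨b, hb, e⟩ := (h.2 a ho).1
    exact ⟨b, hb, e⟩

theorem optimalityEquations_of_tight (hx : x ∈ G.optPol) (h : ∀ a, ∃ b, G.tight x a b) :
    G.OptimalityEquations x := by
  refine ⟨fun a ho => ?_, fun a ho => ?_⟩
  · refine ⟨h a, ?_⟩
    rintro r ⟨b, hb, rfl⟩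
    exact (hx a b hb).1 ho
  · refine ⟨h a, ?_⟩
    rintro r ⟨b, hb, rfl⟩
    exact (hx a b hb).2 ho

theorem OptimalityEquations.unique (h : G.OptimalityEquations x) (h' : G.OptimalityEquations x') :
    x = x' := by
  have key : ∀ {x x' : Fin n → ℝ}, G.OptimalityEquations x → G.OptimalityEquations x' →
      ∀ a, ∃ b, (G.owner a).sgn * (x a - x' a) ≤ G.lam * |x b - x' b| := by
    intro x x' h h' a
    obtain ⟨b, hb, e⟩ := h.exists_tight a
    refine ⟨b, ?_⟩
    have h2 := mem_optPol_iff.1 h'.mem_optPol a b hb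
    have h3 := le_abs_self ((G.owner a).sgn * (x b - x' b))
    rw [abs_mul, Player.abs_sgn, one_mul] at h3
    unfold slack at h2
    have h4 := mul_le_mul_of_nonneg_left h3 G.lam_pos.le
    rw [e]
    nlinarith
  refine eq_of_forall_exists_abs_sub_le G.lam_lt_one (fun a => ?_) G.lam_pos
  have h3 : |x a - x' a| = |(G.owner a).sgn * (x a - x' a)| := by
    rw [abs_mul, Player.abs_sgn, one_mul]
  rw [h3]
  rcases abs_choice ((G.owner a).sgn * (x a - x' a)) with e | e
  · rw [e]; exact key h h' a
  · rw [e]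
    obtain ⟨b, hb⟩ := key h' h a
    exact ⟨b, by rw [abs_sub_comm]; linarith⟩

theorem OptimalityEquations.isValueVector (h : G.OptimalityEquations x) : G.IsValueVector x :=
  ⟨h, fun _ hy => hy.unique h⟩

theorem rate_nonpos_of_tight (hδ : IsDNPValue G.lam G.owner (G.tight x) δ) {a b : Fin n}
    (hab : G.tight x a b) : G.rate δ a b ≤ 0 := by
  have := hδ.le hab
  unfold rate
  linarith

theorem slack_pos_of_rate_pos (hx : x ∈ G.optPol) (hδ : IsDNPValue G.lam G.owner (G.tight x) δ)
    {a b : Fin n} (hab : G.E a b) (h : 0 < G.rate δ a b) : 0 < G.slack x a b := by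
  refine (mem_optPol_iff.1 hx a b hab).lt_of_ne fun e => ?_
  exact absurd (rate_nonpos_of_tight hδ (tight_iff.2 ⟨hab, e.symm⟩)) (not_le.2 h)

/-- A sink has the worst value for its owner, while any target, discounted, is worth at least `-lam`
to that owner. -/
theorem rate_pos_of_sink (hδ : IsDNPValue G.lam G.owner (G.tight x) δ) {a : Fin n}
    (ha : ∀ b, ¬ G.tight x a b) (b : Fin n) : 0 < G.rate δ a b := by
  rcases hδ.eq_or a with ⟨b, hb, -⟩ | ⟨-, e⟩
  · exact absurd hb (ha b)
  · have h1 := hδ.abs_le_one G.lam_pos G.lam_lt_one b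
    have h2 : |(G.owner a).sgn * δ b| ≤ 1 := by rwa [abs_mul, Player.abs_sgn, one_mul]
    unfold rate
    rw [e]
    have h3 := (abs_le.1 h2).1
    have h4 := G.lam_pos
    have h5 := G.lam_lt_one
    have h6 := (G.owner a).sgn_mul_self
    nlinarith

theorem optimalityEquations_of_rate_nonpos (hx : x ∈ G.optPol)
    (hδ : IsDNPValue G.lam G.owner (G.tight x) δ) (h : ∀ a b, G.E a b → G.rate δ a b ≤ 0) :
    G.OptimalityEquations x := by
  refine optimalityEquations_of_tight hx fun a => ?_
  by_contra hc
  push Not at hc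
  obtain ⟨b, hb⟩ := G.exists_edge a
  exact absurd (h a b hb) (not_le.2 (rate_pos_of_sink hδ hc b))

theorem tight_add {a b : Fin n} (hab : G.tight x a b) (e : δ a = G.lam * δ b) :
    G.tight (x + ε • δ) a b := by
  rw [tight_iff] at *
  refine ⟨hab.1, ?_⟩
  rw [slack_add, hab.2, rate_eq_zero_iff.2 e]
  ring

theorem dnpStep_of_tight (hδ : IsDNPValue G.lam G.owner (G.tight x) δ)
    (hx' : ∀ a b, G.tight (x + ε • δ) a b → G.tight x' a b) {a b : Fin n}
    (hab : G.tight (x + ε • δ) a b) (hr : 0 < G.rate δ a b) :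
    DNPStep G.lam G.owner (G.tight x) (G.tight x') :=
  ⟨δ, hδ, fun _ _ hcd e => hx' _ _ (tight_add hcd e), a, b, hx' a b hab, rate_pos_iff.1 hr⟩

/-- The ratio test of linear programming: `ε` is the least quotient of slack and rate over the edges
of positive rate. Such edges exist because `x` is not optimal, and their slacks are positive because
tight edges have rate at most `0`. -/
theorem exists_polyStep (hx : x ∈ G.optPol) (hne : ¬ G.OptimalityEquations x) :
    ∃ x', G.PolyStep x x' := by
  classical
  obtain ⟨δ, hδ⟩ := exists_isDNPValue G.owner (G.tight x) G.lam_pos G.lam_lt_one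
  let V := Finset.univ.filter fun p : Fin n × Fin n => G.E p.1 p.2 ∧ 0 < G.rate δ p.1 p.2
  have hV : V.Nonempty := by
    by_contra hV
    refine hne (optimalityEquations_of_rate_nonpos hx hδ fun a b hab => ?_)
    by_contra hr
    exact hV ⟨(a, b), by simpa [V] using ⟨hab, not_le.1 hr⟩⟩
  obtain ⟨⟨a, b⟩, hab, hmin⟩ :=
    V.exists_min_image (fun p => G.slack x p.1 p.2 / G.rate δ p.1 p.2) hV
  simp only [V, Finset.mem_filter, Finset.mem_univ, true_and, Prod.forall] at hab hmin
  have hpos : 0 < G.slack x a b / G.rate δ a b :=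
    div_pos (slack_pos_of_rate_pos hx hδ hab.1 hab.2) hab.2
  have hfeas : x + (G.slack x a b / G.rate δ a b) • δ ∈ G.optPol := by
    refine mem_optPol_iff.2 fun c d hcd => ?_
    rw [slack_add]
    rcases le_or_gt (G.rate δ c d) 0 with h | h
    · have := mem_optPol_iff.1 hx c d hcd
      nlinarith
    · have := hmin c d ⟨hcd, h⟩
      rw [le_div_iff₀ h] at this
      linarith
  refine ⟨_, hx, hne, δ, _, hδ, ⟨⟨hpos, hfeas⟩, ?_⟩, hfeas, fun _ _ h => h⟩
  rintro ε ⟨-, hε⟩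
  have := mem_optPol_iff.1 hε a b hab.1
  rw [slack_add] at this
  rw [le_div_iff₀ hab.2]
  linarith

/-- Optimal edges have rate `0` and remain tight. Some edge of positive rate, that is, a violating
one, becomes tight: otherwise a second ratio test at `x + ε • δ` would lengthen the step. -/
theorem PolyStep.dnpStep (h : G.PolyStep x x') :
    DNPStep G.lam G.owner (G.tight x) (G.tight x') := by
  classical
  obtain ⟨hx, hne, δ, ε, hδ, ⟨⟨hε, hfeas⟩, hmax⟩, -, hx'⟩ := h
  suffices ∃ a b, G.tight (x + ε • δ) a b ∧ 0 < G.rate δ a b by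
    obtain ⟨a, b, hab, hr⟩ := this
    exact dnpStep_of_tight hδ hx' hab hr
  by_contra hc
  push Not at hc
  let V := Finset.univ.filter fun p : Fin n × Fin n => G.E p.1 p.2 ∧ 0 < G.rate δ p.1 p.2
  have hslack : ∀ a b, G.E a b → 0 < G.rate δ a b → 0 < G.slack (x + ε • δ) a b :=
    fun a b hab hr => (mem_optPol_iff.1 hfeas a b hab).lt_of_ne fun e =>
      absurd (hc a b (tight_iff.2 ⟨hab, e.symm⟩)) (not_le.2 hr)
  have hV : V.Nonempty := by
    by_contra hV
    refine hne (optimalityEquations_of_rate_nonpos hx hδ fun a b hab => ?_)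
    by_contra hr
    exact hV ⟨(a, b), by simpa [V] using ⟨hab, not_le.1 hr⟩⟩
  obtain ⟨⟨a, b⟩, hab, hmin⟩ :=
    V.exists_min_image (fun p => G.slack (x + ε • δ) p.1 p.2 / G.rate δ p.1 p.2) hV
  simp only [V, Finset.mem_filter, Finset.mem_univ, true_and, Prod.forall] at hab hmin
  have hpos : 0 < G.slack (x + ε • δ) a b / G.rate δ a b := div_pos (hslack a b hab.1 hab.2) hab.2
  refine absurd (hmax ⟨add_pos hε hpos, ?_⟩) (not_le.2 (lt_add_of_pos_right ε hpos))
  refine mem_optPol_iff.2 fun c d hcd => ?_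
  rw [add_smul, ← add_assoc, slack_add]
  rcases le_or_gt (G.rate δ c d) 0 with h | h
  · have := mem_optPol_iff.1 hfeas c d hcd
    nlinarith
  · have := hmin c d ⟨hcd, h⟩
    rw [le_div_iff₀ h] at this
    linarith

end DiscountedGame

/-! ### Values of truncated discounted normal play games -/

section Trunc

variable {n : ℕ} {lam : ℝ} {owner : Fin n → Player} {H : Fin n → Fin n → Prop} {δ : Fin n → ℝ}

/-- The payoff `v`, replaced by `0` if the game lasts for `k` moves or more. -/
noncomputable def truncPayoff (lam : ℝ) (k : ℕ) (v : ℝ) : ℝ := if lam ^ k < |v| then v else 0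

theorem truncPayoff_mono (k : ℕ) (h0 : 0 < lam) {u v : ℝ} (huv : u ≤ v) :
    truncPayoff lam k u ≤ truncPayoff lam k v := by
  have := pow_pos h0 k
  unfold truncPayoff
  split_ifs with hu hv hv
  · exact huv
  · by_contra h
    push Not at h hv
    rw [abs_of_pos h] at hu
    linarith [le_abs_self v]
  · by_contra h
    push Not at h hu
    rw [abs_of_neg h] at hv
    linarith [neg_le_abs u]
  · exact le_rfl

theorem truncPayoff_succ_mul (k : ℕ) (h0 : 0 < lam) (v : ℝ) :
    truncPayoff lam (k + 1) (lam * v) = lam * truncPayoff lam k v := by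
  have : lam ^ (k + 1) < |lam * v| ↔ lam ^ k < |v| := by
    rw [pow_succ', abs_mul, abs_of_pos h0, mul_lt_mul_iff_right₀ h0]
  simp only [truncPayoff, this]
  split_ifs <;> simp

theorem truncPayoff_sgn_mul (k : ℕ) (p : Player) (v : ℝ) :
    truncPayoff lam k (p.sgn * v) = p.sgn * truncPayoff lam k v := by
  unfold truncPayoff
  rw [abs_mul, Player.abs_sgn, one_mul]
  split_ifs <;> simp

theorem abs_truncPayoff_le (k : ℕ) (v : ℝ) : |truncPayoff lam k v| ≤ |v| := by
  unfold truncPayoff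
  split_ifs <;> simp

theorem truncPayoff_zero {v : ℝ} (hv : |v| ≤ 1) : truncPayoff lam 0 v = 0 := by
  unfold truncPayoff
  rw [pow_zero, if_neg (not_lt.2 hv)]

/-- Nonzero values have exponent below `n`, so stopping the game after `n` moves loses nothing. -/
theorem IsDNPValue.truncPayoff_card (h : IsDNPValue lam owner H δ) (h0 : 0 < lam) (h1 : lam < 1)
    (a : Fin n) : truncPayoff lam n (δ a) = δ a := by
  have hlt : ∀ s < n, lam ^ n < |lam ^ s| := fun s hs => by
    rw [abs_of_pos (pow_pos h0 s)]
    exact pow_right_strictAnti₀ h0 h1 hs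
  unfold truncPayoff
  rcases h.trichotomy h0 h1 a with e | ⟨s, hs, e | e⟩
  · simp [e]
  · rw [e, if_pos (hlt s hs)]
  · rw [e, abs_neg, if_pos (hlt s hs)]

/-- Truncation is monotone, commutes with signs and turns a factor `lam` into one more move, so the
truncated values obey the same recursion as `y`. Allowing the losing value also at non-sinks is
harmless, since it is the worst one. -/
theorem IsDNPValue.truncPayoff_succ (h : IsDNPValue lam owner H δ) (h0 : 0 < lam) (h1 : lam < 1)
    {k : ℕ} {a : Fin n} {y : ℝ} (hy : -1 ≤ (owner a).sgn * y)
    (hle : ∀ b, H a b → lam * ((owner a).sgn * truncPayoff lam k (δ b)) ≤ (owner a).sgn * y)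
    (heq : y = -(owner a).sgn ∨ ∃ b, H a b ∧ y = lam * truncPayoff lam k (δ b)) :
    y = truncPayoff lam (k + 1) (δ a) := by
  have hss := (owner a).sgn_mul_self
  set z := truncPayoff lam (k + 1) (δ a) with hz
  have hz1 : -1 ≤ (owner a).sgn * z := by
    have h2 : |(owner a).sgn * z| ≤ 1 := by
      rw [abs_mul, Player.abs_sgn, one_mul]
      exact (abs_truncPayoff_le _ _).trans (h.abs_le_one h0 h1 a)
    exact (abs_le.1 h2).1
  have hz2 : ∀ b, H a b → lam * ((owner a).sgn * truncPayoff lam k (δ b)) ≤ (owner a).sgn * z := by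
    intro b hb
    rw [hz, ← truncPayoff_sgn_mul, ← truncPayoff_sgn_mul, ← truncPayoff_succ_mul k h0]
    exact truncPayoff_mono _ h0 (h.le hb)
  have hz3 : z = -(owner a).sgn ∨ ∃ b, H a b ∧ z = lam * truncPayoff lam k (δ b) := by
    rcases h.eq_or a with ⟨b, hb, e⟩ | ⟨-, e⟩
    · exact Or.inr ⟨b, hb, by rw [hz, e, truncPayoff_succ_mul k h0]⟩
    · refine Or.inl ?_
      rw [hz, e, truncPayoff, if_pos]
      rw [abs_neg, Player.abs_sgn]
      exact pow_lt_one₀ h0.le h1 (Nat.succ_ne_zero k)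
  refine (owner a).sgn_mul_inj.1 (le_antisymm ?_ ?_)
  · rcases heq with e | ⟨b, hb, e⟩
    · rw [e, mul_neg, hss]; exact hz1
    · rw [e]; linarith [hz2 b hb]
  · rcases hz3 with e | ⟨b, hb, e⟩
    · rw [e, mul_neg, hss]; exact hy
    · rw [e]; linarith [hle b hb]

end Trunc

/-! ### Bit-lengths -/

/-- `x` is a fraction of integers of absolute value at most `2 ^ B`, not necessarily reduced. -/
def IsFrac (B : ℕ) (x : ℝ) : Prop :=
  ∃ (p : ℤ) (q : ℕ), 0 < q ∧ |p| ≤ 2 ^ B ∧ q ≤ 2 ^ B ∧ x = p / q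

section IsFrac

variable {A B : ℕ} {x y : ℝ}

theorem IsFrac.mono (h : IsFrac A x) (hAB : A ≤ B) : IsFrac B x := by
  obtain ⟨p, q, hq, hp, hqA, e⟩ := h
  exact ⟨p, q, hq, hp.trans (pow_le_pow_right₀ (by norm_num) hAB),
    hqA.trans (Nat.pow_le_pow_right (by norm_num) hAB), e⟩

theorem isFrac_zero : IsFrac 0 0 := ⟨0, 1, by simp⟩

theorem isFrac_one : IsFrac 0 1 := ⟨1, 1, by simp⟩

theorem IsFrac.neg (h : IsFrac A x) : IsFrac A (-x) := by
  obtain ⟨p, q, hq, hp, hqA, e⟩ := h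
  exact ⟨-p, q, hq, by rwa [abs_neg], hqA, by rw [e]; push_cast; ring⟩

theorem IsFrac.add (hx : IsFrac A x) (hy : IsFrac B y) : IsFrac (A + B + 1) (x + y) := by
  obtain ⟨p, q, hq, hp, hqA, rfl⟩ := hx
  obtain ⟨r, s, hs, hr, hsB, rfl⟩ := hy
  have hqA' : (q : ℤ) ≤ 2 ^ A := by exact_mod_cast hqA
  have hsB' : (s : ℤ) ≤ 2 ^ B := by exact_mod_cast hsB
  refine ⟨p * s + r * q, q * s, Nat.mul_pos hq hs, ?_, ?_, ?_⟩
  · calc |p * s + r * q| ≤ |p| * s + |r| * q := by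
          refine (abs_add_le _ _).trans ?_
          rw [abs_mul, abs_mul, Nat.abs_cast, Nat.abs_cast]
      _ ≤ 2 ^ A * 2 ^ B + 2 ^ B * 2 ^ A := by gcongr
      _ = 2 ^ (A + B + 1) := by ring
  · calc q * s ≤ 2 ^ A * 2 ^ B := Nat.mul_le_mul hqA hsB
      _ ≤ 2 ^ (A + B + 1) := by rw [← pow_add]; exact Nat.pow_le_pow_right (by norm_num) (by omega)
  · have : (q : ℝ) ≠ 0 := by positivity
    have : (s : ℝ) ≠ 0 := by positivity
    push_cast
    field_simp

theorem IsFrac.mul (hx : IsFrac A x) (hy : IsFrac B y) : IsFrac (A + B) (x * y) := by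
  obtain ⟨p, q, hq, hp, hqA, rfl⟩ := hx
  obtain ⟨r, s, hs, hr, hsB, rfl⟩ := hy
  refine ⟨p * r, q * s, Nat.mul_pos hq hs, ?_, ?_, ?_⟩
  · rw [abs_mul, pow_add]; gcongr
  · rw [pow_add]; exact Nat.mul_le_mul hqA hsB
  · push_cast
    rw [div_mul_div_comm]

theorem IsFrac.inv (hx : IsFrac A x) : IsFrac A x⁻¹ := by
  obtain ⟨p, q, hq, hp, hqA, rfl⟩ := hx
  rcases eq_or_ne p 0 with rfl | hp0
  · simpa using isFrac_zero.mono (Nat.zero_le A)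
  · have hq' : (q : ℤ) ≤ 2 ^ A := by exact_mod_cast hqA
    refine ⟨p.sign * q, p.natAbs, Int.natAbs_pos.2 hp0, ?_, ?_, ?_⟩
    · rw [abs_mul, Int.abs_sign_of_ne_zero hp0, Nat.abs_cast, one_mul]; exact hq'
    · rw [Int.abs_eq_natAbs] at hp
      exact_mod_cast hp
    · have hq0 : (q : ℝ) ≠ 0 := by positivity
      have hp1 : (p : ℝ) ≠ 0 := by exact_mod_cast hp0
      have hp2 : (p.natAbs : ℝ) ≠ 0 := by exact_mod_cast Int.natAbs_ne_zero.2 hp0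
      have hs : ((p.sign : ℤ) : ℝ) * (p.natAbs : ℝ) = p := by
        rw [← Int.cast_natCast, ← Int.cast_mul, Int.sign_mul_natAbs]
      have hs2 : ((p.sign : ℤ) : ℝ) * (p.sign : ℤ) = 1 := by
        rcases lt_or_gt_of_ne hp0 with h | h
        · rw [Int.sign_eq_neg_one_of_neg h]; norm_num
        · rw [Int.sign_eq_one_of_pos h]; norm_num
      push_cast
      rw [inv_div, div_eq_div_iff hp1 hp2]
      calc (q : ℝ) * p.natAbs = q * p.natAbs * (((p.sign : ℤ) : ℝ) * (p.sign : ℤ)) := by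
            rw [hs2, mul_one]
        _ = ((p.sign : ℤ) : ℝ) * q * (((p.sign : ℤ) : ℝ) * p.natAbs) := by ring
        _ = _ := by rw [hs]

theorem IsFrac.div (hx : IsFrac A x) (hy : IsFrac B y) : IsFrac (A + B) (x / y) := by
  rw [div_eq_mul_inv]
  exact hx.mul hy.inv

theorem IsFrac.pow (hx : IsFrac A x) (k : ℕ) : IsFrac (k * A) (x ^ k) := by
  induction k with
  | zero => simpa using isFrac_one
  | succ k ih => rw [pow_succ, add_mul, one_mul]; exact ih.mul hx

theorem IsFrac.sum {f : ℕ → ℝ} (hf : ∀ i, IsFrac A (f i)) (k : ℕ) :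
    IsFrac (k * (A + 1)) (∑ i ∈ Finset.range k, f i) := by
  induction k with
  | zero => simpa using isFrac_zero
  | succ k ih =>
    rw [Finset.sum_range_succ]
    refine (ih.add (hf k)).mono (le_of_eq ?_)
    ring

/-- Reduction to lowest terms only shrinks numerator and denominator; a number up to `2 ^ B`
inclusive may need `B + 1` bits. -/
theorem IsFrac.hasBitLength (h : IsFrac B x) : HasBitLength (2 * B + 2) x := by
  obtain ⟨p, q, hq, hp, hqA, rfl⟩ := h
  refine ⟨(p : ℚ) / ((q : ℤ) : ℚ), by push_cast; rfl, ?_⟩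
  have hq0 : ((q : ℤ)) ≠ 0 := by exact_mod_cast hq.ne'
  have h1 : (((p : ℚ) / ((q : ℤ) : ℚ)).num.natAbs) ≤ 2 ^ B := by
    rcases eq_or_ne p 0 with rfl | hp0
    · simp
    · have := Nat.le_of_dvd (Int.natAbs_pos.2 hp0)
        (Int.natAbs_dvd_natAbs.2 (Rat.num_dvd p hq0))
      rw [Int.abs_eq_natAbs] at hp
      rw [Rat.divInt_eq_div] at this
      exact this.trans (by exact_mod_cast hp)
  have h2 : (((p : ℚ) / ((q : ℤ) : ℚ)).den) ≤ 2 ^ B := by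
    have := Nat.le_of_dvd hq (by exact_mod_cast Rat.den_dvd p q)
    rw [Rat.divInt_eq_div] at this
    exact this.trans hqA
  have hlt : 2 ^ B < 2 ^ (B + 1) := Nat.pow_lt_pow_right (by norm_num) (by omega)
  have h3 := Nat.size_le.2 (h1.trans_lt hlt)
  have h4 := Nat.size_le.2 (h2.trans_lt hlt)
  omega

theorem HasBitLength.isFrac (h : HasBitLength B x) : IsFrac B x := by
  obtain ⟨q, rfl, hq⟩ := h
  have h1 : q.num.natAbs ≤ 2 ^ B := (Nat.lt_size_self _).le.trans
    (Nat.pow_le_pow_right (by norm_num) (by omega))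
  have h2 : q.den ≤ 2 ^ B := (Nat.lt_size_self _).le.trans
    (Nat.pow_le_pow_right (by norm_num) (by omega))
  refine ⟨q.num, q.den, q.den_pos, ?_, h2, ?_⟩
  · rw [Int.abs_eq_natAbs]; exact_mod_cast h1
  · exact Rat.cast_def q

end IsFrac

/-! ### Numbers of polynomial bit-length in the data of a game. -/

namespace DiscountedGame

variable {n : ℕ} {G : DiscountedGame n}

/-- If the discount factor and the weights of `G` are rationals of bit-length at most `B`, then `r`
is a fraction of integers of bit-length `c * n ^ 2 * B`. -/
def IsShort (G : DiscountedGame n) (c : ℕ) (r : ℝ) : Prop :=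
  ∀ B, G.HasBitLength B → IsFrac (c * (n ^ 2 * B)) r

section IsShort

variable {c d : ℕ} {r s : ℝ}

theorem HasBitLength.pos {B : ℕ} (h : G.HasBitLength B) : 0 < B := by
  obtain ⟨q, -, hq⟩ := h.1
  have := Nat.size_pos.2 q.den_pos
  omega

theorem IsShort.mono (h : G.IsShort c r) (hcd : c ≤ d) : G.IsShort d r :=
  fun B hB => (h B hB).mono (Nat.mul_le_mul_right _ hcd)

theorem isShort_zero : G.IsShort 0 0 := fun _ _ => isFrac_zero.mono (Nat.zero_le _)

theorem isShort_one : G.IsShort 0 1 := fun _ _ => isFrac_one.mono (Nat.zero_le _)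

theorem IsShort.neg (h : G.IsShort c r) : G.IsShort c (-r) := fun B hB => (h B hB).neg

theorem isShort_sgn (p : Player) : G.IsShort 0 p.sgn := by
  cases p
  · exact isShort_one
  · exact isShort_one.neg

theorem IsShort.mul (hr : G.IsShort c r) (hs : G.IsShort d s) : G.IsShort (c + d) (r * s) :=
  fun B hB => ((hr B hB).mul (hs B hB)).mono (by rw [add_mul])

theorem IsShort.div (hr : G.IsShort c r) (hs : G.IsShort d s) : G.IsShort (c + d) (r / s) :=
  fun B hB => ((hr B hB).div (hs B hB)).mono (by rw [add_mul])

theorem isShort_lam_pow {k : ℕ} (hk : k ≤ n) : G.IsShort 1 (G.lam ^ k) := fun B hB =>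
  (hB.1.isFrac.pow k).mono (by
    have : n ≤ n ^ 2 := Nat.le_self_pow (by norm_num) n
    rw [one_mul]
    exact Nat.mul_le_mul_right _ (hk.trans this))

theorem isShort_dnpValue {H : Fin n → Fin n → Prop} {δ : Fin n → ℝ}
    (h : IsDNPValue G.lam G.owner H δ) (a : Fin n) : G.IsShort 1 (δ a) := by
  rcases h.trichotomy G.lam_pos G.lam_lt_one a with e | ⟨s, hs, e | e⟩
  · rw [e]; exact isShort_zero.mono (Nat.zero_le 1)
  · rw [e]; exact isShort_lam_pow hs.le
  · rw [e]; exact (isShort_lam_pow hs.le).neg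

theorem isShort_truncPayoff {k : ℕ} (h : G.IsShort c r) : G.IsShort c (truncPayoff G.lam k r) := by
  unfold truncPayoff
  split_ifs
  · exact h
  · exact isShort_zero.mono (Nat.zero_le c)

theorem affine_iterate {α : Type*} {lam : ℝ} {f : α → α} {v A : α → ℝ}
    (hA : ∀ a, A a = v a + lam * A (f a)) (a : α) (k : ℕ) :
    A a = ∑ i ∈ Finset.range k, lam ^ i * v (f^[i] a) + lam ^ k * A (f^[k] a) := by
  induction k with
  | zero => simp
  | succ k ih =>
    rw [Finset.sum_range_succ, Function.iterate_succ_apply', ih]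
    nth_rw 1 [hA (f^[k] a)]
    ring

variable [NeZero n]

theorem HasBitLength.one_le_sq_mul {B : ℕ} (h : G.HasBitLength B) : 1 ≤ n ^ 2 * B :=
  Nat.mul_pos (pow_pos (NeZero.pos n) 2) h.pos

theorem IsShort.add (hr : G.IsShort c r) (hs : G.IsShort d s) : G.IsShort (c + d + 1) (r + s) :=
  fun B hB => ((hr B hB).add (hs B hB)).mono (by have := hB.one_le_sq_mul; nlinarith)

theorem IsShort.sub (hr : G.IsShort c r) (hs : G.IsShort d s) : G.IsShort (c + d + 1) (r - s) := by
  rw [sub_eq_add_neg]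
  exact hr.add hs.neg

theorem isShort_lam : G.IsShort 1 G.lam := by
  simpa using isShort_lam_pow (G := G) (k := 1) (NeZero.pos n)

theorem isShort_weight {a b : Fin n} (hab : G.E a b) : G.IsShort 1 (G.w a b) := fun B hB =>
  (hB.2 a b hab).isFrac.mono (by
    have : 1 ≤ n ^ 2 := pow_pos (NeZero.pos n) 2
    nlinarith)

/-- The orbit of `a` enters a cycle within `n` steps. On a cycle of length `p` the recurrence closes
up and gives `A` as a discounted sum divided by `1 - lam ^ p`; elsewhere `A` is a discounted sum
plus a power of `lam` times a value on the cycle. -/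
theorem isShort_of_affine {f : Fin n → Fin n} {v A : Fin n → ℝ}
    (hv : ∀ B, G.HasBitLength B → ∀ a, IsFrac B (v a))
    (hA : ∀ a, A a = v a + G.lam * A (f a)) (a : Fin n) : G.IsShort 10 (A a) := by
  have hsum : ∀ k ≤ n, ∀ a, G.IsShort 3 (∑ i ∈ Finset.range k, G.lam ^ i * v (f^[i] a)) := by
    intro k hk a B hB
    have h1 : ∀ i, IsFrac (n * B + B) (if i < n then G.lam ^ i * v (f^[i] a) else 0) := by
      intro i
      split_ifs with hi
      · refine ((hB.1.isFrac.pow i).mono ?_).mul (hv B hB _)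
        exact Nat.mul_le_mul_right _ hi.le
      · exact isFrac_zero.mono (Nat.zero_le _)
    have h2 := IsFrac.sum h1 k
    rw [Finset.sum_congr rfl fun i hi => if_pos ((Finset.mem_range.1 hi).trans_le hk)] at h2
    refine h2.mono ?_
    have hn : 1 ≤ n := NeZero.pos n
    have hB1 := hB.pos
    have h3 : n * B ≤ n ^ 2 * B := Nat.mul_le_mul_right _ (Nat.le_self_pow (by norm_num) n)
    have h4 : n ≤ n * B := Nat.le_mul_of_pos_right n hB1
    calc k * (n * B + B + 1) ≤ n * (n * B + B + 1) := Nat.mul_le_mul_right _ hk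
      _ = n ^ 2 * B + n * B + n := by ring
      _ ≤ 3 * (n ^ 2 * B) := by omega
  obtain ⟨i, j, hij, he⟩ : ∃ i j : Fin (n + 1), i < j ∧ f^[i] a = f^[j] a := by
    obtain ⟨i, j, hne, he⟩ := Fintype.exists_ne_map_eq_of_card_lt
      (fun i : Fin (n + 1) => f^[i] a) (by simp)
    rcases lt_or_gt_of_ne hne with h | h
    · exact ⟨i, j, h, he⟩
    · exact ⟨j, i, h, he.symm⟩
  have hij' : (i : ℕ) < j := hij
  have hjn : (j : ℕ) ≤ n := Nat.lt_succ_iff.1 j.2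
  have hcyc : f^[(j : ℕ) - i] (f^[i] a) = f^[i] a := by
    rw [← Function.iterate_add_apply, Nat.sub_add_cancel hij'.le, he]
  have hc := affine_iterate hA (f^[i] a) ((j : ℕ) - i)
  rw [hcyc] at hc
  have hpow : G.lam ^ ((j : ℕ) - i) < 1 := pow_lt_one₀ G.lam_pos.le G.lam_lt_one (by omega)
  have hAc : A (f^[i] a) = (∑ l ∈ Finset.range ((j : ℕ) - i), G.lam ^ l * v (f^[l] (f^[i] a))) /
      (1 - G.lam ^ ((j : ℕ) - i)) := by
    rw [eq_div_iff (by linarith)]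
    linarith
  have h1 : G.IsShort 5 (A (f^[i] a)) := by
    rw [hAc]
    exact (hsum _ (by omega) _).div (isShort_one.sub (isShort_lam_pow (by omega)))
  rw [affine_iterate hA a i]
  exact (hsum _ (by omega) _).add ((isShort_lam_pow (by omega)).mul h1)

/-- A point at which the sinks of a DNP game have values `± t`, the optimal edges of the game are tight and
so is some other edge has short coordinates. -/
theorem isShort_of_tight {H : Fin n → Fin n → Prop} {δ x : Fin n → ℝ} {t : ℝ}
    (hδ : IsDNPValue G.lam G.owner H δ)
    (hx : ∀ a b, H a b → δ a = G.lam * δ b → G.tight x a b)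
    (ht : ∀ a, (∀ b, ¬ H a b) → x a = (G.owner a).sgn * t) {a b : Fin n} (hab : G.tight x a b)
    (hr : G.rate δ a b ≠ 0) (c : Fin n) : G.IsShort 50 (x c) := by
  classical
  -- Along an optimal edge `t • δ` satisfies the homogeneous recurrence, so adding it preserves the
  -- one for `x`. At a sink `x + t • δ` vanishes, so the sink can be given a loop of weight `0`.
  have hex : ∀ a, ∃ p : Fin n × ℝ, (∀ B, G.HasBitLength B → IsFrac B p.2) ∧
      x a + δ a * t = p.2 + G.lam * (x p.1 + δ p.1 * t) := by
    intro a
    rcases hδ.eq_or a with ⟨b, hb, e⟩ | ⟨hs, e⟩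
    · have h2 := hx a b hb e
      refine ⟨(b, G.w a b), fun B hB => (hB.2 a b h2.1).isFrac, ?_⟩
      rw [h2.2, e]; ring
    · refine ⟨(a, 0), fun B _ => isFrac_zero.mono (Nat.zero_le _), ?_⟩
      rw [ht a hs, e]; ring
  choose p hp1 hp2 using hex
  have hA := isShort_of_affine (G := G) (f := fun a => (p a).1) (v := fun a => (p a).2)
    (A := fun a => x a + δ a * t) (fun B hB a => hp1 a B hB) hp2
  have hr' : G.lam * δ b - δ a ≠ 0 := fun h => hr (by rw [rate, h, mul_zero])
  -- Tightness of an edge of nonzero rate is a linear equation that determines `t`.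
  have hte : t = (G.w a b + G.lam * (x b + δ b * t) - (x a + δ a * t)) / (G.lam * δ b - δ a) := by
    rw [eq_div_iff hr', hab.2]; ring
  have hts : G.IsShort 30 t := by
    rw [hte]
    exact ((((isShort_weight hab.1).add (isShort_lam.mul (hA b))).sub (hA a)).div
      ((isShort_lam.mul (isShort_dnpValue hδ b)).sub (isShort_dnpValue hδ a))).mono (by norm_num)
  have : x c = (x c + δ c * t) - δ c * t := by ring
  rw [this]
  exact ((hA c).sub ((isShort_dnpValue hδ c).mul hts)).mono (by norm_num)

end IsShort

end DiscountedGame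

/-! ### Program logic -/

/-- The variable part of the memory: the counters, which are cells `0` of the natural-number arrays from
the third on, three real arrays, and a real variable. -/
structure Store where
  c : ℕ → ℕ
  x : ℕ → ℝ
  d : ℕ → ℝ
  sg : ℕ → ℝ
  m : ℝ

theorem HasBitLength.mono {A B : ℕ} {r : ℝ} (h : HasBitLength A r) (hAB : A ≤ B) :
    HasBitLength B r := by
  obtain ⟨q, e, hq⟩ := h
  exact ⟨q, e, hq.trans hAB⟩

theorem Exec.mono {I J : Mem → Prop} (hIJ : ∀ s, I s → J s) {p : Prog} {s s' : Mem} {t : ℕ}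
    (h : Exec I p s t s') : Exec J p s t s' := by
  induction h with
  | skip s h => exact .skip s (hIJ _ h)
  | setN s k i e h h' => exact .setN s k i e (hIJ _ h) (hIJ _ h')
  | setR s k i e h h' => exact .setR s k i e (hIJ _ h) (hIJ _ h')
  | seq s s₁ s₂ t₁ t₂ c d _ _ ih₁ ih₂ => exact .seq s s₁ s₂ t₁ t₂ c d ih₁ ih₂
  | iteTrue s s' t b c d hb _ ih => exact .iteTrue s s' t b c d hb ih
  | iteFalse s s' t b c d hb _ ih => exact .iteFalse s s' t b c d hb ih
  | loopStop s b c h hb => exact .loopStop s b c (hIJ _ h) hb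
  | loopStep s s₁ s₂ t₁ t₂ b c hb _ _ ih₁ ih₂ => exact .loopStep s s₁ s₂ t₁ t₂ b c hb ih₁ ih₂

theorem Fin.mul_add_inj {n : ℕ} {k l : ℕ} {a b : Fin n} :
    k * n + a = l * n + b ↔ k = l ∧ a = b := by
  refine ⟨fun h => ?_, fun ⟨h1, h2⟩ => by rw [h1, h2]⟩
  have hn : 0 < n := a.pos
  have h1 := congrArg (· / n) h
  have h2 := congrArg (· % n) h
  simp only [mul_comm _ n, Nat.mul_add_div hn, Nat.mul_add_mod, Nat.div_eq_of_lt a.2,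
    Nat.div_eq_of_lt b.2, Nat.mod_eq_of_lt a.2, Nat.mod_eq_of_lt b.2] at h1 h2
  exact ⟨by simpa using h1, Fin.ext h2⟩

theorem Fin.mul_add_lt {n k l : ℕ} (a : Fin n) (hk : k < l) : k * n + a < l * n := by
  calc k * n + a < k * n + n := by have := a.2; omega
    _ = (k + 1) * n := by ring
    _ ≤ l * n := Nat.mul_le_mul_right n hk

namespace DiscountedGame

variable {n : ℕ} {G : DiscountedGame n}

/-- The memory that holds the input `G` and the store `st`. -/
noncomputable def memory (G : DiscountedGame n) (st : Store) : Mem where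
  N
    | 0, i => G.input.N 0 i
    | 1, i => G.input.N 1 i
    | 2, i => G.input.N 2 i
    | q + 3, i => if i = 0 then st.c q else 0
  R
    | 2, i => st.x i
    | 3, i => st.d i
    | 4, i => st.sg i
    | 5, i => if i = 0 then st.m else 0
    | q, i => G.input.R q i

/-- The cells with addresses from `n * n + n` on are empty, and the others hold short numbers. -/
def ShortArray (G : DiscountedGame n) (f : ℕ → ℝ) : Prop :=
  (∀ i, n * n + n ≤ i → f i = 0) ∧ ∀ i, G.IsShort 1000 (f i)

theorem ShortArray.update {f : ℕ → ℝ} (hf : G.ShortArray f) {i : ℕ} {v : ℝ} (hi : i < n * n + n)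
    (hv : G.IsShort 1000 v) : G.ShortArray (Function.update f i v) := by
  refine ⟨fun j hj => ?_, fun j => ?_⟩
  · rw [Function.update_of_ne (by omega)]; exact hf.1 j hj
  · rcases eq_or_ne j i with rfl | h
    · rw [Function.update_self]; exact hv
    · rw [Function.update_of_ne h]; exact hf.2 j

/-- The single invariant of all memories met, from which both the space and the bit-length bounds
follow. The counters may reach `n`, at the end of a loop. -/
structure ShortStore (G : DiscountedGame n) (st : Store) : Prop where
  c : ∀ q, st.c q ≤ n
  x : G.ShortArray st.x
  d : G.ShortArray st.d
  sg : G.ShortArray st.sg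
  m : G.IsShort 1000 st.m

/-- Started in the store `st`, the program `p` reaches within `T` steps a store that satisfies `Q`,
and it only meets short stores on the way. -/
def Runs (G : DiscountedGame n) (st : Store) (p : Prog) (T : ℕ) (Q : Store → Prop) : Prop :=
  ∃ t st', Exec (fun s => ∃ st, G.ShortStore st ∧ s = G.memory st) p (G.memory st) t (G.memory st') ∧
    t ≤ T ∧ G.ShortStore st' ∧ Q st'

section Runs

variable {st : Store} {p p' : Prog} {b : BExp} {T T' : ℕ} {Q Q' : Store → Prop}

theorem Runs.mono (h : G.Runs st p T Q) (hT : T ≤ T') (hQ : ∀ s, G.ShortStore s → Q s → Q' s) :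
    G.Runs st p T' Q' := by
  obtain ⟨t, s, he, ht, hs, hq⟩ := h
  exact ⟨t, s, he, ht.trans hT, hs, hQ s hs hq⟩

theorem Runs.skip (hst : G.ShortStore st) (hQ : Q st) : G.Runs st .skip 1 Q :=
  ⟨1, st, .skip _ ⟨st, hst, rfl⟩, le_rfl, hst, hQ⟩

theorem Runs.seq (h : G.Runs st p T Q) (h' : ∀ s, G.ShortStore s → Q s → G.Runs s p' T' Q') :
    G.Runs st (.seq p p') (T + T') Q' := by
  obtain ⟨t, s, he, ht, hs, hq⟩ := h
  obtain ⟨t', s', he', ht', hs', hq'⟩ := h' s hs hq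
  exact ⟨t + t', s', .seq _ _ _ _ _ _ _ he he', Nat.add_le_add ht ht', hs', hq'⟩

theorem Runs.ite (h : b.Holds (G.memory st) → G.Runs st p T Q)
    (h' : ¬ b.Holds (G.memory st) → G.Runs st p' T Q) :
    G.Runs st (.ite b p p') (b.cost + 1 + T) Q := by
  by_cases hb : b.Holds (G.memory st)
  · obtain ⟨t, s, he, ht, hs, hq⟩ := h hb
    exact ⟨_, s, .iteTrue _ _ _ _ _ _ hb he, Nat.add_le_add_left ht _, hs, hq⟩
  · obtain ⟨t, s, he, ht, hs, hq⟩ := h' hb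
    exact ⟨_, s, .iteFalse _ _ _ _ _ _ hb he, Nat.add_le_add_left ht _, hs, hq⟩

/-- Termination is read off from the invariant, which must imply `i < L` whenever the guard holds.
-/
theorem Runs.loop {Inv : ℕ → Store → Prop} {L : ℕ} (hst : G.ShortStore st) (h0 : Inv 0 st)
    (h : ∀ i s, G.ShortStore s → Inv i s → b.Holds (G.memory s) →
      i < L ∧ G.Runs s p T (Inv (i + 1))) :
    G.Runs st (.loop b p) (L * (b.cost + 1 + T) + (b.cost + 1))
      (fun s => ¬ b.Holds (G.memory s) ∧ ∃ i, Inv i s) := by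
  have key : ∀ k i s, k + i = L → G.ShortStore s → Inv i s →
      G.Runs s (.loop b p) (k * (b.cost + 1 + T) + (b.cost + 1))
        (fun s => ¬ b.Holds (G.memory s) ∧ ∃ i, Inv i s) := by
    intro k
    induction k with
    | zero =>
      intro i s hi hs hinv
      by_cases hb : b.Holds (G.memory s)
      · exact absurd (h i s hs hinv hb).1 (by omega)
      · exact ⟨_, s, .loopStop _ _ _ ⟨s, hs, rfl⟩ hb, by omega, hs, hb, i, hinv⟩
    | succ k ih =>
      intro i s hi hs hinv
      by_cases hb : b.Holds (G.memory s)
      · obtain ⟨t, s', he, ht, hs', hq⟩ := (h i s hs hinv hb).2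
        obtain ⟨t', s'', he', ht', hs'', hq'⟩ := ih (i + 1) s' (by omega) hs' hq
        refine ⟨_, s'', .loopStep _ _ _ _ _ _ _ hb he he', ?_, hs'', hq'⟩
        rw [add_mul, one_mul]
        omega
      · refine ⟨_, s, .loopStop _ _ _ ⟨s, hs, rfl⟩ hb, ?_, hs, hb, i, hinv⟩
        exact Nat.le_add_left _ _
  exact key L 0 st rfl hst h0

theorem memory_writeN (q v : ℕ) :
    (G.memory st).writeN (q + 3) 0 v = G.memory { st with c := Function.update st.c q v } := by
  unfold memory Mem.writeN
  congr 1
  funext k i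
  rcases k with _ | _ | _ | k
  · rw [Function.update_of_ne (by omega)]
  · rw [Function.update_of_ne (by omega)]
  · rw [Function.update_of_ne (by omega)]
  · rcases eq_or_ne k q with rfl | hk
    · rw [Function.update_self]
      rcases eq_or_ne i 0 with rfl | hi
      · simp
      · simp [hi]
    · rw [Function.update_of_ne (by omega)]
      simp [hk]

theorem memory_writeR_two (i : ℕ) (v : ℝ) :
    (G.memory st).writeR 2 i v = G.memory { st with x := Function.update st.x i v } := by
  unfold memory Mem.writeR
  congr 1
  funext k j
  rcases k with _ | _ | _ | _ | _ | _ | k <;> simp [Function.update]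

theorem memory_writeR_three (i : ℕ) (v : ℝ) :
    (G.memory st).writeR 3 i v = G.memory { st with d := Function.update st.d i v } := by
  unfold memory Mem.writeR
  congr 1
  funext k j
  rcases k with _ | _ | _ | _ | _ | _ | k <;> simp [Function.update]

theorem memory_writeR_four (i : ℕ) (v : ℝ) :
    (G.memory st).writeR 4 i v = G.memory { st with sg := Function.update st.sg i v } := by
  unfold memory Mem.writeR
  congr 1
  funext k j
  rcases k with _ | _ | _ | _ | _ | _ | k <;> simp [Function.update]

theorem memory_writeR_five (v : ℝ) :
    (G.memory st).writeR 5 0 v = G.memory { st with m := v } := by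
  unfold memory Mem.writeR
  congr 1
  funext k j
  rcases k with _ | _ | _ | _ | _ | _ | k <;> simp [Function.update]
  rcases eq_or_ne j 0 with rfl | hj <;> simp [*]

theorem Runs.setC {q v : ℕ} {e : NExp} (hst : G.ShortStore st) (he : e.eval (G.memory st) = v)
    (hv : v ≤ n) (hQ : Q { st with c := Function.update st.c q v }) :
    G.Runs st (.setN (q + 3) (.lit 0) e) (e.cost + 2) Q := by
  have hs : G.ShortStore { st with c := Function.update st.c q v } := by
    refine ⟨fun r => ?_, hst.x, hst.d, hst.sg, hst.m⟩
    rcases eq_or_ne r q with rfl | h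
    · simpa using hv
    · simpa [h] using hst.c r
  have hw : (G.memory st).writeN (q + 3) ((NExp.lit 0).eval (G.memory st)) (e.eval (G.memory st)) =
      G.memory { st with c := Function.update st.c q v } := by
    rw [he]; exact memory_writeN q v
  have := Exec.setN (I := fun s => ∃ st, G.ShortStore st ∧ s = G.memory st) _ (q + 3) (.lit 0) e
    ⟨st, hst, rfl⟩ ⟨_, hs, hw⟩
  refine ⟨_, _, hw ▸ this, ?_, hs, hQ⟩
  simp only [NExp.cost]
  omega

theorem Runs.setX {i : NExp} {e : RExp} {a : ℕ} {v : ℝ} (hst : G.ShortStore st)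
    (hi : i.eval (G.memory st) = a) (ha : a < n * n + n) (he : e.eval (G.memory st) = v)
    (hv : G.IsShort 1000 v) (hQ : Q { st with x := Function.update st.x a v }) :
    G.Runs st (.setR 2 i e) (i.cost + e.cost + 1) Q := by
  have hs : G.ShortStore { st with x := Function.update st.x a v } :=
    ⟨hst.c, hst.x.update ha hv, hst.d, hst.sg, hst.m⟩
  have hw : (G.memory st).writeR 2 (i.eval (G.memory st)) (e.eval (G.memory st)) =
      G.memory { st with x := Function.update st.x a v } := by
    rw [he, hi]; exact memory_writeR_two a v
  exact ⟨_, _, hw ▸ Exec.setR _ 2 i e ⟨st, hst, rfl⟩ ⟨_, hs, hw⟩, le_rfl, hs, hQ⟩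

theorem Runs.setD {i : NExp} {e : RExp} {a : ℕ} {v : ℝ} (hst : G.ShortStore st)
    (hi : i.eval (G.memory st) = a) (ha : a < n * n + n) (he : e.eval (G.memory st) = v)
    (hv : G.IsShort 1000 v) (hQ : Q { st with d := Function.update st.d a v }) :
    G.Runs st (.setR 3 i e) (i.cost + e.cost + 1) Q := by
  have hs : G.ShortStore { st with d := Function.update st.d a v } :=
    ⟨hst.c, hst.x, hst.d.update ha hv, hst.sg, hst.m⟩
  have hw : (G.memory st).writeR 3 (i.eval (G.memory st)) (e.eval (G.memory st)) =
      G.memory { st with d := Function.update st.d a v } := by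
    rw [he, hi]; exact memory_writeR_three a v
  exact ⟨_, _, hw ▸ Exec.setR _ 3 i e ⟨st, hst, rfl⟩ ⟨_, hs, hw⟩, le_rfl, hs, hQ⟩

theorem Runs.setSg {i : NExp} {e : RExp} {a : ℕ} {v : ℝ} (hst : G.ShortStore st)
    (hi : i.eval (G.memory st) = a) (ha : a < n * n + n) (he : e.eval (G.memory st) = v)
    (hv : G.IsShort 1000 v) (hQ : Q { st with sg := Function.update st.sg a v }) :
    G.Runs st (.setR 4 i e) (i.cost + e.cost + 1) Q := by
  have hs : G.ShortStore { st with sg := Function.update st.sg a v } :=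
    ⟨hst.c, hst.x, hst.d, hst.sg.update ha hv, hst.m⟩
  have hw : (G.memory st).writeR 4 (i.eval (G.memory st)) (e.eval (G.memory st)) =
      G.memory { st with sg := Function.update st.sg a v } := by
    rw [he, hi]; exact memory_writeR_four a v
  exact ⟨_, _, hw ▸ Exec.setR _ 4 i e ⟨st, hst, rfl⟩ ⟨_, hs, hw⟩, le_rfl, hs, hQ⟩

theorem Runs.setM {e : RExp} {v : ℝ} (hst : G.ShortStore st) (he : e.eval (G.memory st) = v)
    (hv : G.IsShort 1000 v) (hQ : Q { st with m := v }) :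
    G.Runs st (.setR 5 (.lit 0) e) (e.cost + 2) Q := by
  have hs : G.ShortStore { st with m := v } := ⟨hst.c, hst.x, hst.d, hst.sg, hv⟩
  have hw : (G.memory st).writeR 5 ((NExp.lit 0).eval (G.memory st)) (e.eval (G.memory st)) =
      G.memory { st with m := v } := by
    rw [he]; exact memory_writeR_five v
  have := Exec.setR (I := fun s => ∃ st, G.ShortStore st ∧ s = G.memory st) _ 5 (.lit 0) e
    ⟨st, hst, rfl⟩ ⟨_, hs, hw⟩
  refine ⟨_, _, hw ▸ this, ?_, hs, hQ⟩
  simp only [NExp.cost]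
  omega

/-! ### Reading the memory -/

theorem memory_size : (G.memory st).N 0 0 = n := by
  simp [memory, input]

theorem memory_counter (q : ℕ) : (G.memory st).N (q + 3) 0 = st.c q := by
  simp [memory]

theorem memory_owner (a : Fin n) : 0 < (G.memory st).N 1 a ↔ G.owner a = Player.max := by
  simp only [memory, input]
  rw [if_neg (by simp)]
  split_ifs with h1 h2
  · obtain ⟨-, c, hc, e⟩ := h1
    rw [Fin.ext e]
    simp [hc]
  · exact absurd h2.1 (by norm_num)
  · refine ⟨fun h => absurd h (lt_irrefl 0), fun h => absurd ⟨rfl, a, h, rfl⟩ h1⟩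

theorem memory_edge (a b : Fin n) : 0 < (G.memory st).N 2 (a * n + b) ↔ G.E a b := by
  simp only [memory, input]
  rw [if_neg (by simp), if_neg (by simp)]
  split_ifs with h
  · obtain ⟨-, c, d, hcd, e⟩ := h
    obtain ⟨h1, rfl⟩ := Fin.mul_add_inj.1 e
    rw [Fin.ext h1]
    simp [hcd]
  · refine ⟨fun h' => absurd h' (lt_irrefl 0), fun h' => absurd ⟨rfl, a, b, h', rfl⟩ h⟩

theorem memory_lam : (G.memory st).R 0 0 = G.lam := by
  simp [memory, input]

theorem memory_weight {a b : Fin n} (hab : G.E a b) :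
    (G.memory st).R 1 (a * n + b) = G.w a b := by
  simp only [memory, input]
  rw [if_neg (by simp), if_pos trivial, Finset.sum_eq_single a, Finset.sum_eq_single b]
  · exact if_pos ⟨hab, rfl⟩
  · exact fun c _ hc => if_neg fun h => hc (Fin.mul_add_inj.1 h.2).2.symm
  · simp
  · exact fun c _ hc => Finset.sum_eq_zero fun d _ => if_neg fun h =>
      hc (Fin.ext (Fin.mul_add_inj.1 h.2).1).symm
  · simp

theorem memory_weight_zero {a b : Fin n} (hab : ¬ G.E a b) :
    (G.memory st).R 1 (a * n + b) = 0 := by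
  simp only [memory, input]
  rw [if_neg (by simp), if_pos trivial]
  refine Finset.sum_eq_zero fun c _ => Finset.sum_eq_zero fun d _ => if_neg ?_
  rintro ⟨h, e⟩
  obtain ⟨h1, rfl⟩ := Fin.mul_add_inj.1 e
  exact hab (Fin.ext h1 ▸ h)

theorem memory_x (i : ℕ) : (G.memory st).R 2 i = st.x i := rfl

theorem memory_d (i : ℕ) : (G.memory st).R 3 i = st.d i := rfl

theorem memory_sg (i : ℕ) : (G.memory st).R 4 i = st.sg i := rfl

end Runs

/-- The counter `q` runs over the nodes. -/
def _root_.Solver.forNodes (q : ℕ) (p : Prog) : Prog :=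
  .seq (.setN (q + 3) (.lit 0) (.lit 0))
    (.loop (.ltN (.get (q + 3) (.lit 0)) (.get 0 (.lit 0)))
      (.seq p (.setN (q + 3) (.lit 0) (.add (.get (q + 3) (.lit 0)) (.lit 1)))))

/-- The overhead per node is `6` for the guard and `6` for the increment; `9` is the initialisation
and the final guard. -/
theorem Runs.forNodes {st : Store} {p : Prog} {T q : ℕ} {Inv : ℕ → Store → Prop}
    (hst : G.ShortStore st) (h0 : Inv 0 { st with c := Function.update st.c q 0 })
    (h : ∀ (i : Fin n) (s : Store), G.ShortStore s → s.c q = i → Inv i s →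
      G.Runs s p T fun s => s.c q = i ∧ Inv (i + 1) { s with c := Function.update s.c q (i + 1) }) :
    G.Runs st (Solver.forNodes q p) (n * (T + 12) + 9) (Inv n) := by
  have hloop : ∀ s, G.ShortStore s → s.c q = 0 ∧ Inv 0 s →
      G.Runs s (.loop (.ltN (.get (q + 3) (.lit 0)) (.get 0 (.lit 0)))
        (.seq p (.setN (q + 3) (.lit 0) (.add (.get (q + 3) (.lit 0)) (.lit 1)))))
        (n * (6 + (T + 6)) + 6) (Inv n) := by
    rintro s hs hinv
    refine Runs.mono (Runs.loop (Inv := fun i s => s.c q = i ∧ Inv i s) (L := n) (T := T + 6) hs hinv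
      ?_) (by simp [BExp.cost, NExp.cost]) ?_
    · rintro i s hs ⟨hi, hinv⟩ hb
      simp only [BExp.Holds, NExp.eval, memory_counter, memory_size, hi] at hb
      refine ⟨hb, Runs.seq (h ⟨i, hb⟩ s hs hi hinv) ?_⟩
      rintro s hs ⟨hi, hinv⟩
      exact Runs.setC (v := i + 1) hs (by simp [NExp.eval, memory_counter, hi]) hb
        ⟨by simp, hinv⟩
    · rintro s hs ⟨hb, i, hi, hinv⟩
      simp only [BExp.Holds, NExp.eval, memory_counter, memory_size, hi] at hb
      have := hs.c q
      rwa [show n = i by omega]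
  refine Runs.mono (Runs.seq (Runs.setC (v := 0) (Q := fun s => s.c q = 0 ∧ Inv 0 s) hst rfl
    (Nat.zero_le n) ⟨by simp, h0⟩) hloop) ?_ fun _ _ h => h
  simp only [NExp.cost]
  apply le_of_eq
  ring

end DiscountedGame

/-! ### The program -/

namespace Solver

def counter (q : ℕ) : NExp := .get (q + 3) (.lit 0)

def address (e f : NExp) : NExp := .add (.mul e (.get 0 (.lit 0))) f

def edgeTest : BExp := .ltN (.lit 0) (.get 2 (address (counter 1) (counter 2)))

def weight : RExp := .get 1 (address (counter 1) (counter 2))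

def lam : RExp := .get 0 (.lit 0)

def best : RExp := .get 5 (.lit 0)

def sgn : RExp := .get 4 (counter 1)

def slack : RExp :=
  .mul sgn (.sub (.sub (.get 2 (counter 1)) weight) (.mul lam (.get 2 (counter 2))))

/-- The rate of the pair of nodes in the counters, where `δ a` and `δ b` are read from the given rows. -/
def rate (k l : NExp) : RExp :=
  .mul sgn (.sub (.mul lam (.get 3 (address l (counter 2)))) (.get 3 (address k (counter 1))))

/-- Compute the maximum of the squares of the weights. -/
def maxWeight : Prog :=
  forNodes 1 (forNodes 2
    -- Squares replace absolute values. No edge test is needed: non-edges hold `0`, which never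
    -- exceeds the current maximum.
    (.ite (.ltR best (.mul weight weight)) (.setR 5 (.lit 0) (.mul weight weight)) .skip))

/-- Compute the signs of the nodes and a first point of the optimality polyhedron. -/
def initialPoint : Prog :=
  .seq (.setR 5 (.lit 0) (.div (.add best (.lit 1)) (.sub (.lit 1) lam)))
    (forNodes 1 (.seq
      (.ite (.ltN (.lit 0) (.get 1 (counter 1))) (.setR 4 (counter 1) (.lit 1))
        (.setR 4 (counter 1) (.sub (.lit 0) (.lit 1))))
      (.setR 2 (counter 1) (.mul sgn best))))

def nextRow : NExp := .add (counter 0) (.lit 1)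

/-- Compute the values of the DNP game on the tight edges: row `k` of the array holds the values of the game
that is stopped after `k` moves. -/
def dnpValues : Prog :=
  forNodes 0 (forNodes 1 (.seq
    (.setR 3 (address nextRow (counter 1)) (.sub (.lit 0) sgn))
    (forNodes 2 (.ite
      -- Slacks of edges are nonnegative inside the polyhedron, so not being positive means being
      -- tight.
      (.and edgeTest (.and (.not (.ltR (.lit 0) slack)) (.ltR (.lit 0) (rate nextRow (counter 0)))))
      (.setR 3 (address nextRow (counter 1)) (.mul lam (.get 3 (address (counter 0) (counter 2)))))
      .skip))))

def lastRow : NExp := .get 0 (.lit 0)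

/-- Compute the reciprocal of the largest feasible step. -/
def stepLength : Prog :=
  .seq (.setR 5 (.lit 0) (.lit 0))
    (forNodes 1 (forNodes 2 (.ite
      (.and edgeTest (.ltR (.mul best slack) (rate lastRow lastRow)))
      (.setR 5 (.lit 0) (.div (rate lastRow lastRow) slack)) .skip)))

/-- Here `best` is `1 / ε`; it is `0` when no edge has positive rate, which also ends the main loop.
-/
def move : Prog :=
  .ite (.ltR (.lit 0) best)
    (forNodes 1 (.setR 2 (counter 1)
      (.add (.get 2 (counter 1)) (.div (.get 3 (address lastRow (counter 1))) best))))
    .skip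

def program : Prog :=
  -- The value `1` only serves to enter the loop.
  .seq maxWeight (.seq initialPoint (.seq (.setR 5 (.lit 0) (.lit 1))
    (.loop (.ltR (.lit 0) best) (.seq dnpValues (.seq stepLength move)))))

end Solver

/-! ### Meaning of the expressions of the program, and its initialisation. -/

namespace DiscountedGame

variable {n : ℕ} {G : DiscountedGame n} {st : Store}

section Eval

variable {a b : Fin n}

theorem eval_counter (q : ℕ) : (Solver.counter q).eval (G.memory st) = st.c q :=
  memory_counter q

theorem eval_address (e f : NExp) : (Solver.address e f).eval (G.memory st) =
    e.eval (G.memory st) * n + f.eval (G.memory st) := by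
  simp only [Solver.address, NExp.eval, memory_size]

theorem eval_lastRow : Solver.lastRow.eval (G.memory st) = n := memory_size

theorem eval_nextRow : Solver.nextRow.eval (G.memory st) = st.c 0 + 1 := by
  simp only [Solver.nextRow, NExp.eval, eval_counter]

theorem holds_edgeTest (ha : st.c 1 = a) (hb : st.c 2 = b) :
    Solver.edgeTest.Holds (G.memory st) ↔ G.E a b := by
  simp only [Solver.edgeTest, BExp.Holds, NExp.eval, eval_address, eval_counter, ha, hb, memory_edge]

theorem eval_weight (ha : st.c 1 = a) (hb : st.c 2 = b) (hab : G.E a b) :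
    Solver.weight.eval (G.memory st) = G.w a b := by
  simp only [Solver.weight, RExp.eval, eval_address, eval_counter, ha, hb, memory_weight hab]

theorem eval_weight_zero (ha : st.c 1 = a) (hb : st.c 2 = b) (hab : ¬ G.E a b) :
    Solver.weight.eval (G.memory st) = 0 := by
  simp only [Solver.weight, RExp.eval, eval_address, eval_counter, ha, hb, memory_weight_zero hab]

theorem eval_lam : Solver.lam.eval (G.memory st) = G.lam := memory_lam

theorem eval_best : Solver.best.eval (G.memory st) = st.m := rfl

theorem eval_sgn (ha : st.c 1 = a) : Solver.sgn.eval (G.memory st) = st.sg a := by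
  simp only [Solver.sgn, RExp.eval, eval_counter, ha, memory_sg]

theorem eval_slack (ha : st.c 1 = a) (hb : st.c 2 = b) (hab : G.E a b)
    (hsg : st.sg a = (G.owner a).sgn) {x : Fin n → ℝ} (hx : ∀ a : Fin n, st.x a = x a) :
    Solver.slack.eval (G.memory st) = G.slack x a b := by
  simp only [Solver.slack, RExp.eval, eval_sgn ha, eval_weight ha hb hab, eval_lam, eval_counter, ha,
    hb, hsg, memory_x, hx, slack]

theorem eval_rate (ha : st.c 1 = a) (hb : st.c 2 = b) (hsg : st.sg a = (G.owner a).sgn)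
    (k l : NExp) : (Solver.rate k l).eval (G.memory st) =
      (G.owner a).sgn * (G.lam * st.d (l.eval (G.memory st) * n + b) -
        st.d (k.eval (G.memory st) * n + a)) := by
  simp only [Solver.rate, RExp.eval, eval_sgn ha, eval_lam, eval_address, eval_counter, ha,
    hb, hsg, memory_d]

end Eval

theorem node_lt (a : Fin n) : (a : ℕ) < n * n + n := by
  have := a.2
  omega

theorem row_lt {k : ℕ} (hk : k ≤ n) (a : Fin n) : k * n + a < n * n + n := by
  have := Fin.mul_add_lt a (Nat.lt_succ_of_le hk)
  rwa [Nat.succ_mul] at this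

/-- Every slack is at least `t * (1 - lam) - |w| = m + 1 - |w|`, and `|w| ≤ w ^ 2 + 1`. -/
theorem mem_optPol_of_weights {t m : ℝ} (ht : t = (m + 1) / (1 - G.lam))
    (hmw : ∀ a b, G.E a b → G.w a b * G.w a b ≤ m) :
    (fun a => (G.owner a).sgn * t) ∈ G.optPol := by
  refine mem_optPol_iff.2 fun a b hab => ?_
  have h1 : 0 < 1 - G.lam := by linarith [G.lam_lt_one]
  have h2 : t * (1 - G.lam) = m + 1 := by rw [ht, div_mul_cancel₀ _ h1.ne']
  have h3 := hmw a b hab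
  have h0 : 0 ≤ m := (mul_self_nonneg _).trans h3
  have ht0 : 0 ≤ t := by rw [ht]; positivity
  have h4 := G.lam_pos
  have h5 : 0 ≤ G.lam * t := mul_nonneg h4.le ht0
  unfold slack
  cases ha : G.owner a <;> cases hb : G.owner b <;> simp only [ha, hb, Player.sgn] <;>
    nlinarith [sq_nonneg (G.w a b - 1), sq_nonneg (G.w a b + 1)]

section Run

variable [NeZero n]

theorem runs_maxWeight (hst : G.ShortStore st) (hm : st.m = 0) :
    G.Runs st Solver.maxWeight (n * (n * (60 + 12) + 9 + 12) + 9) fun s =>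
      s.d = st.d ∧ G.IsShort 2 s.m ∧ ∀ a b, G.E a b → G.w a b * G.w a b ≤ s.m := by
  refine Runs.mono (Runs.forNodes (T := n * (60 + 12) + 9) (Inv := fun i s => s.d = st.d ∧
    G.IsShort 2 s.m ∧ 0 ≤ s.m ∧ ∀ a b : Fin n, a < i → G.E a b → G.w a b * G.w a b ≤ s.m) hst ?_ ?_)
    le_rfl ?_
  · refine ⟨rfl, ?_, ?_, fun a b h => absurd h (Nat.not_lt_zero _)⟩
    · simp only [hm]; exact isShort_zero.mono (by norm_num)
    · simp only [hm]; exact le_rfl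
  · rintro a s hs ha ⟨hd, hms, hm0, hmw⟩
    refine Runs.mono (Runs.forNodes (T := 60) (Inv := fun i s => s.c 1 = a ∧ s.d = st.d ∧
      G.IsShort 2 s.m ∧ 0 ≤ s.m ∧ ∀ c d : Fin n, (c < a ∨ c = a ∧ d < i) → G.E c d →
        G.w c d * G.w c d ≤ s.m) hs ?_ ?_) le_rfl ?_
    · refine ⟨by simpa using ha, hd, hms, hm0, ?_⟩
      rintro c d (h | h) hcd
      · exact hmw c d h hcd
      · exact absurd h.2 (Nat.not_lt_zero _)
    · rintro b s hs hb ⟨ha, hd, hms, hm0, hmw⟩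
      refine Runs.mono (Runs.ite (T := 26) ?_ ?_) (by decide) fun _ _ h => h
      · intro hlt
        simp only [BExp.Holds, RExp.eval, eval_best] at hlt
        have hab : G.E a b := by
          by_contra hab
          rw [eval_weight_zero ha hb hab] at hlt
          linarith
        rw [eval_weight ha hb hab] at hlt
        refine Runs.mono (Runs.setM (v := G.w a b * G.w a b) hs ?_
          (((isShort_weight hab).mul (isShort_weight hab)).mono (by norm_num)) ?_)
          (by decide) fun _ _ h => h
        · simp only [RExp.eval, eval_weight ha hb hab]
        · refine ⟨hb, by simpa using ha, hd, (isShort_weight hab).mul (isShort_weight hab),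
            mul_self_nonneg _, ?_⟩
          intro c d hcd hE
          by_cases h : c = a ∧ d = b
          · rw [h.1, h.2]
          · refine (hmw c d ?_ hE).trans hlt.le
            rcases hcd with h1 | ⟨h1, h2⟩
            · exact Or.inl h1
            · refine Or.inr ⟨h1, lt_of_le_of_ne (Nat.lt_succ_iff.1 h2) fun e => h ⟨h1, Fin.ext e⟩⟩
      · intro hlt
        simp only [BExp.Holds, RExp.eval, eval_best] at hlt
        refine Runs.mono (Runs.skip hs ?_) (by norm_num) fun _ _ h => h
        refine ⟨hb, by simpa using ha, hd, hms, hm0, fun c d hcd hE => ?_⟩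
        by_cases h : c = a ∧ d = b
        · obtain ⟨rfl, rfl⟩ := h
          rw [eval_weight ha hb hE] at hlt
          exact not_lt.1 hlt
        · refine hmw c d ?_ hE
          rcases hcd with h1 | ⟨h1, h2⟩
          · exact Or.inl h1
          · refine Or.inr ⟨h1, lt_of_le_of_ne (Nat.lt_succ_iff.1 h2) fun e => h ⟨h1, Fin.ext e⟩⟩
    · rintro s hs ⟨ha, hd, hms, hm0, hmw⟩
      refine ⟨ha, hd, hms, hm0, fun c d hc hcd => hmw c d ?_ hcd⟩
      rcases (Nat.lt_succ_iff.1 hc).lt_or_eq with h | h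
      · exact Or.inl h
      · exact Or.inr ⟨Fin.ext h, d.2⟩
  · rintro s hs ⟨hd, hms, -, hmw⟩
    exact ⟨hd, hms, fun a b hab => hmw a b a.2 hab⟩

theorem runs_initialPoint (hst : G.ShortStore st) (hm : G.IsShort 2 st.m)
    (hmw : ∀ a b, G.E a b → G.w a b * G.w a b ≤ st.m) :
    G.Runs st Solver.initialPoint (20 + (n * (40 + 12) + 9)) fun s =>
      s.d = st.d ∧ ∃ t, G.IsShort 5 t ∧ (fun a => (G.owner a).sgn * t) ∈ G.optPol ∧
        ∀ a : Fin n, s.sg a = (G.owner a).sgn ∧ s.x a = (G.owner a).sgn * t := by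
  obtain ⟨t, ht⟩ : ∃ t, t = (st.m + 1) / (1 - G.lam) := ⟨_, rfl⟩
  have hts : G.IsShort 5 t := by
    rw [ht]
    exact (hm.add isShort_one).div (isShort_one.sub isShort_lam)
  refine Runs.seq (Q := fun s => s.d = st.d ∧ s.m = t) (Runs.mono (Runs.setM (v := t) hst ?_
    (hts.mono (by norm_num)) ⟨rfl, rfl⟩) (by decide) fun _ _ h => h) ?_
  · simp only [RExp.eval, eval_best, eval_lam, Nat.cast_one, ht]
  rintro s hs ⟨hd, hsm⟩
  refine Runs.mono (Runs.forNodes (T := 40) (Inv := fun i s => s.d = st.d ∧ s.m = t ∧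
    ∀ a : Fin n, a < i → s.sg a = (G.owner a).sgn ∧ s.x a = (G.owner a).sgn * t) hs ?_ ?_)
    le_rfl ?_
  · exact ⟨hd, hsm, fun a h => absurd h (Nat.not_lt_zero _)⟩
  · rintro a s hs ha ⟨hd, hsm, hsx⟩
    refine Runs.mono (Runs.seq (T := 20) (T' := 12) (Q := fun s => s.c 1 = a ∧ s.d = st.d ∧ s.m = t ∧
      s.sg a = (G.owner a).sgn ∧ ∀ c : Fin n, c < a → s.sg c = (G.owner c).sgn ∧
        s.x c = (G.owner c).sgn * t) ?_ ?_) (by norm_num) fun _ _ h => h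
    · refine Runs.mono (Runs.ite (T := 10) ?_ ?_) (by decide) fun _ _ h => h
      · intro h
        simp only [BExp.Holds, NExp.eval, eval_counter, ha, memory_owner] at h
        refine Runs.mono (Runs.setSg (a := a) (v := 1) hs ((eval_counter 1).trans ha) (node_lt a)
          (by simp [RExp.eval]) (isShort_one.mono (by norm_num)) ?_) (by decide) fun _ _ h => h
        refine ⟨ha, hd, hsm, by simp [h, Player.sgn], fun c hc => ?_⟩
        have hne : (c : ℕ) ≠ a := fun e => absurd hc (by rw [Fin.ext e]; exact lt_irrefl _)
        simpa [hne] using hsx c hc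
      · intro h
        simp only [BExp.Holds, NExp.eval, eval_counter, ha, memory_owner] at h
        have h : G.owner a = Player.min := by
          cases ho : G.owner a
          · exact absurd ho h
          · rfl
        refine Runs.mono (Runs.setSg (a := a) (v := -1) hs ((eval_counter 1).trans ha) (node_lt a)
          (by simp [RExp.eval]) (isShort_one.neg.mono (by norm_num)) ?_) (by decide) fun _ _ h => h
        refine ⟨ha, hd, hsm, by simp [h, Player.sgn], fun c hc => ?_⟩
        have hne : (c : ℕ) ≠ a := fun e => absurd hc (by rw [Fin.ext e]; exact lt_irrefl _)
        simpa [hne] using hsx c hc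
    · rintro s hs ⟨ha, hd, hsm, hsa, hsx⟩
      refine Runs.mono (Runs.setX (a := a) (v := (G.owner a).sgn * t) hs ((eval_counter 1).trans ha)
        (node_lt a) ?_ (((isShort_sgn _).mul hts).mono (by norm_num)) ?_) (by decide)
        fun _ _ h => h
      · simp only [RExp.eval, eval_sgn ha, hsa, eval_best, hsm]
      · refine ⟨ha, hd, hsm, fun c hc => ?_⟩
        by_cases hca : c = a
        · subst hca
          exact ⟨hsa, by simp⟩
        · have hne : (c : ℕ) ≠ a := fun e => hca (Fin.ext e)
          have := hsx c (lt_of_le_of_ne (Nat.lt_succ_iff.1 hc) hca)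
          simpa [hne] using this
  · rintro s hs ⟨hd, hsm, hsx⟩
    exact ⟨hd, t, hts, mem_optPol_of_weights ht hmw, fun a => hsx a a.2⟩

end Run

end DiscountedGame

/-! ### Correctness of the parts of one iteration. -/

namespace DiscountedGame

variable {n : ℕ} {G : DiscountedGame n} {st : Store} {x δ : Fin n → ℝ}

/-- The store holds the signs of the nodes and the point `x`. -/
def Holds (G : DiscountedGame n) (x : Fin n → ℝ) (s : Store) : Prop :=
  ∀ a : Fin n, s.sg a = (G.owner a).sgn ∧ s.x a = x a

/-- The rows up to `k` hold the values of the DNP game stopped after at most `k` moves. -/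
def HoldsRows (G : DiscountedGame n) (δ : Fin n → ℝ) (k : ℕ) (s : Store) : Prop :=
  ∀ l ≤ k, ∀ b : Fin n, s.d (l * n + b) = truncPayoff G.lam l (δ b)

/-- The first `i` cells of row `k + 1` hold the values of the DNP game stopped after `k + 1` moves. -/
def HoldsCells (G : DiscountedGame n) (δ : Fin n → ℝ) (k i : ℕ) (s : Store) : Prop :=
  ∀ b : Fin n, b < i → s.d ((k + 1) * n + b) = truncPayoff G.lam (k + 1) (δ b)

theorem HoldsRows.update {k : ℕ} {a : Fin n} {v : ℝ} (h : G.HoldsRows δ k st) :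
    G.HoldsRows δ k { st with d := Function.update st.d ((k + 1) * n + a) v } := fun l hl b => by
  have := Fin.mul_add_lt b (show l < k + 1 by omega)
  dsimp only
  rw [Function.update_of_ne (by omega)]
  exact h l hl b

theorem HoldsCells.update {k : ℕ} {a : Fin n} {v : ℝ} (h : G.HoldsCells δ k a st) :
    G.HoldsCells δ k a { st with d := Function.update st.d ((k + 1) * n + a) v } := fun b hb => by
  dsimp only
  rw [Function.update_of_ne (by omega)]
  exact h b hb

/-- The value `y` is optimal for `a` among the tight edges to the first `i` nodes. -/
def IsPartialValue (G : DiscountedGame n) (x δ : Fin n → ℝ) (k : ℕ) (a : Fin n) (i : ℕ) (y : ℝ) :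
    Prop :=
  -1 ≤ (G.owner a).sgn * y ∧
  (∀ b : Fin n, b < i → G.tight x a b →
    G.lam * ((G.owner a).sgn * truncPayoff G.lam k (δ b)) ≤ (G.owner a).sgn * y) ∧
  (y = -(G.owner a).sgn ∨ ∃ b, G.tight x a b ∧ y = G.lam * truncPayoff G.lam k (δ b))

/-- `m` is the reciprocal of the largest feasible step, as far as the edges satisfying `P` are
concerned. -/
def IsStepBound (G : DiscountedGame n) (x δ : Fin n → ℝ) (P : Fin n → Fin n → Prop) (m : ℝ) : Prop :=
  (∀ a b, P a b → G.E a b → G.rate δ a b ≤ m * G.slack x a b) ∧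
  (m = 0 ∨ ∃ a b, G.E a b ∧ 0 < G.rate δ a b ∧ m = G.rate δ a b / G.slack x a b)

theorem IsStepBound.nonneg (hδ : IsDNPValue G.lam G.owner (G.tight x) δ) (hx : x ∈ G.optPol)
    {P : Fin n → Fin n → Prop} {m : ℝ} (h : G.IsStepBound x δ P m) : 0 ≤ m := by
  rcases h.2 with e | ⟨a, b, hab, hr, e⟩
  · exact e.ge
  · rw [e]
    exact (div_pos hr (slack_pos_of_rate_pos hx hδ hab hr)).le

/-- Row `0` of the array of values must remain zero, since the next iteration starts its dynamic
programming from it. -/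
theorem runs_move (hst : G.ShortStore st) (hh : G.Holds x st) (h0 : ∀ b : Fin n, st.d b = 0)
    (hd : ∀ b : Fin n, st.d (n * n + b) = δ b)
    (hshort : 0 < st.m → ∀ a, G.IsShort 50 ((x + st.m⁻¹ • δ) a)) :
    G.Runs st Solver.move (5 + (n * (40 + 12) + 9)) fun s =>
      (∀ b : Fin n, s.d b = 0) ∧ s.m = st.m ∧
        G.Holds (if 0 < st.m then x + st.m⁻¹ • δ else x) s := by
  refine Runs.mono (Runs.ite (T := n * (40 + 12) + 9) ?_ ?_) ?_ fun _ _ h => h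
  · intro hm
    simp only [BExp.Holds, RExp.eval, eval_best, Nat.cast_zero] at hm
    rw [if_pos hm]
    have hshort := hshort hm
    generalize hy : x + st.m⁻¹ • δ = y at hshort ⊢
    refine Runs.mono (Runs.forNodes (T := 40) (Inv := fun i s => s.d = st.d ∧ s.m = st.m ∧
      ∀ a : Fin n, s.sg a = (G.owner a).sgn ∧ s.x a = if (a : ℕ) < i then y a else x a) hst
      ?_ ?_) le_rfl ?_
    · exact ⟨rfl, rfl, fun a => by simpa using hh a⟩
    · rintro a s hs ha ⟨hsd, hsm, hsx⟩
      refine Runs.mono (Runs.setX (a := a) (v := y a) hs ((eval_counter 1).trans ha) (node_lt a) ?_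
        ((hshort a).mono (by norm_num)) ?_) (by decide) fun _ _ h => h
      · have hxa := (hsx a).2
        rw [if_neg (lt_irrefl _)] at hxa
        simp only [RExp.eval, eval_counter, ha, memory_x, eval_address, eval_lastRow, memory_d, hsd, hd,
          eval_best, hsm, hxa, ← hy, Pi.add_apply, Pi.smul_apply, smul_eq_mul]
        rw [div_eq_inv_mul]
      · refine ⟨ha, hsd, hsm, fun c => ⟨(hsx c).1, ?_⟩⟩
        by_cases hca : c = a
        · subst hca
          simp
        · have hne : (c : ℕ) ≠ a := fun e => hca (Fin.ext e)
          have hlt : (c : ℕ) < a + 1 ↔ (c : ℕ) < a := by omega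
          simp only [Function.update_of_ne hne, hlt]
          exact (hsx c).2
    · rintro s hs ⟨hsd, hsm, hsx⟩
      refine ⟨fun b => by rw [hsd, h0], hsm, fun a => ⟨(hsx a).1, ?_⟩⟩
      rw [(hsx a).2, if_pos a.2]
  · intro hm
    simp only [BExp.Holds, RExp.eval, eval_best, Nat.cast_zero] at hm
    rw [if_neg hm]
    exact Runs.mono (Runs.skip hst ⟨h0, rfl, hh⟩) (by omega) fun _ _ h => h
  · have : (BExp.ltR (.lit 0) Solver.best).cost = 4 := by decide
    rw [this]

variable [NeZero n]

/-- The cell starts with the losing value and is improved by every better tight edge; the final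
optimum is identified by `IsDNPValue.truncPayoff_succ`. -/
theorem runs_dnpCell (hδ : IsDNPValue G.lam G.owner (G.tight x) δ) (hx : x ∈ G.optPol)
    {k a : Fin n} (hst : G.ShortStore st) (hk : st.c 0 = k) (ha : st.c 1 = a) (hh : G.Holds x st)
    (hr : G.HoldsRows δ k st) (hc : G.HoldsCells δ k a st) :
    G.Runs st (.seq
      (.setR 3 (Solver.address Solver.nextRow (Solver.counter 1)) (.sub (.lit 0) Solver.sgn))
      (Solver.forNodes 2 (.ite
        (.and Solver.edgeTest (.and (.not (.ltR (.lit 0) Solver.slack))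
          (.ltR (.lit 0) (Solver.rate Solver.nextRow (Solver.counter 0)))))
        (.setR 3 (Solver.address Solver.nextRow (Solver.counter 1))
          (.mul Solver.lam (.get 3 (Solver.address (Solver.counter 0) (Solver.counter 2)))))
        .skip))) (30 + (n * (120 + 12) + 9)) fun s =>
      s.c 0 = k ∧ s.c 1 = a ∧ G.Holds x s ∧ G.HoldsRows δ k s ∧ G.HoldsCells δ k (a + 1) s := by
  have hrow : ((k : ℕ) + 1) * n + a < n * n + n := row_lt k.2 a
  have haddr : ∀ s : Store, s.c 0 = k → s.c 1 = a →
      (Solver.address Solver.nextRow (Solver.counter 1)).eval (G.memory s) =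
        ((k : ℕ) + 1) * n + a := fun s hk ha => by
    rw [eval_address, eval_nextRow, eval_counter, hk, ha]
  have hss := (G.owner a).sgn_mul_self
  refine Runs.seq (Q := fun s => s.c 0 = k ∧ s.c 1 = a ∧ G.Holds x s ∧ G.HoldsRows δ k s ∧
    G.HoldsCells δ k a s ∧ G.IsPartialValue x δ k a 0 (s.d (((k : ℕ) + 1) * n + a))) (Runs.mono
    (Runs.setD (v := -(G.owner a).sgn) hst (haddr st hk ha) hrow ?_
    ((isShort_sgn _).neg.mono (by norm_num)) ?_) (by decide) fun _ _ h => h) ?_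
  · simp [RExp.eval, eval_sgn ha, (hh a).1]
  · refine ⟨hk, ha, hh, hr.update, hc.update, ?_⟩
    dsimp only
    rw [Function.update_self]
    exact ⟨by rw [mul_neg, hss], fun b hb => absurd hb (Nat.not_lt_zero _), Or.inl rfl⟩
  rintro s hs ⟨hk, ha, hh, hr, hc, hp⟩
  refine Runs.mono (Runs.forNodes (T := 120) (Inv := fun i s => s.c 0 = k ∧ s.c 1 = a ∧ G.Holds x s ∧
    G.HoldsRows δ k s ∧ G.HoldsCells δ k a s ∧
    G.IsPartialValue x δ k a i (s.d (((k : ℕ) + 1) * n + a))) hs ?_ ?_) le_rfl ?_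
  · exact ⟨by simpa using hk, by simpa using ha, hh, hr, hc, hp⟩
  · rintro b s hs hb ⟨hk, ha, hh, hr, hc, hp1, hp2, hp3⟩
    have hcond : (BExp.and Solver.edgeTest (.and (.not (.ltR (.lit 0) Solver.slack))
        (.ltR (.lit 0) (Solver.rate Solver.nextRow (Solver.counter 0))))).Holds (G.memory s) ↔
        G.tight x a b ∧ 0 < (G.owner a).sgn *
          (G.lam * truncPayoff G.lam k (δ b) - s.d (((k : ℕ) + 1) * n + a)) := by
      simp only [BExp.Holds, holds_edgeTest ha hb, RExp.eval, eval_rate ha hb (hh a).1,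
        eval_nextRow, eval_counter, hk, hr k le_rfl b, Nat.cast_zero, tight_iff, and_assoc]
      refine and_congr_right fun hab => and_congr_left fun _ => ?_
      rw [eval_slack ha hb hab (hh a).1 fun a => (hh a).2, not_lt]
      exact ⟨fun h => le_antisymm h (mem_optPol_iff.1 hx a b hab), le_of_eq⟩
    refine Runs.mono (Runs.ite (T := 30) ?_ ?_) (by decide) fun _ _ h => h
    · intro h
      obtain ⟨hab, hlt⟩ := hcond.1 h
      refine Runs.mono (Runs.setD (v := G.lam * truncPayoff G.lam k (δ b)) hs (haddr s hk ha) hrow ?_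
        ((isShort_lam.mul (isShort_truncPayoff (isShort_dnpValue hδ b))).mono (by norm_num)) ?_)
        (by decide) fun _ _ h => h
      · simp only [RExp.eval, eval_lam, eval_address, eval_counter, hk, hb, memory_d, hr k le_rfl b]
      · refine ⟨hb, by simpa using hk, by simpa using ha, hh, hr.update, hc.update, ?_⟩
        dsimp only
        rw [Function.update_self]
        refine ⟨by linarith, fun c hc hac => ?_, Or.inr ⟨b, hab, rfl⟩⟩
        rcases (Nat.lt_succ_iff.1 hc).lt_or_eq with h | h
        · have := hp2 c h hac
          linarith
        · rw [Fin.ext h]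
          apply le_of_eq
          ring
    · intro h
      rw [hcond, not_and, not_lt] at h
      refine Runs.mono (Runs.skip hs ?_) (by norm_num) fun _ _ h => h
      refine ⟨hb, by simpa using hk, by simpa using ha, hh, hr, hc, hp1, fun c hc hac => ?_, hp3⟩
      rcases (Nat.lt_succ_iff.1 hc).lt_or_eq with h' | h'
      · exact hp2 c h' hac
      · obtain rfl := Fin.ext h'
        have := h hac
        linarith
  · rintro s hs ⟨hk, ha, hh, hr, hc, hp1, hp2, hp3⟩
    refine ⟨hk, ha, hh, hr, fun b hb => ?_⟩
    rcases (Nat.lt_succ_iff.1 hb).lt_or_eq with h | h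
    · exact hc b h
    · rw [Fin.ext h]
      exact hδ.truncPayoff_succ G.lam_pos G.lam_lt_one hp1 (fun b hab => hp2 b b.2 hab) hp3

theorem runs_dnpValues (hδ : IsDNPValue G.lam G.owner (G.tight x) δ) (hx : x ∈ G.optPol)
    (hst : G.ShortStore st) (hh : G.Holds x st) (h0 : ∀ b : Fin n, st.d b = 0) :
    G.Runs st Solver.dnpValues
      (n * (n * (30 + (n * (120 + 12) + 9) + 12) + 9 + 12) + 9) fun s =>
      G.Holds x s ∧ (∀ b : Fin n, s.d b = 0) ∧ ∀ b : Fin n, s.d (n * n + b) = δ b := by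
  refine Runs.mono (Runs.forNodes (T := n * (30 + (n * (120 + 12) + 9) + 12) + 9)
    (Inv := fun k s => G.Holds x s ∧ G.HoldsRows δ k s) hst ⟨hh, ?_⟩ ?_) le_rfl ?_
  · intro l hl b
    obtain rfl := Nat.le_zero.1 hl
    rw [truncPayoff_zero (hδ.abs_le_one G.lam_pos G.lam_lt_one b)]
    simpa using h0 b
  · rintro k s hs hk ⟨hh, hr⟩
    refine Runs.mono (Runs.forNodes (T := 30 + (n * (120 + 12) + 9)) (Inv := fun i s => s.c 0 = k ∧
      G.Holds x s ∧ G.HoldsRows δ k s ∧ G.HoldsCells δ k i s) hs ?_ ?_) le_rfl ?_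
    · exact ⟨by simpa using hk, hh, hr, fun b hb => absurd hb (Nat.not_lt_zero _)⟩
    · rintro a s hs ha ⟨hk, hh, hr, hc⟩
      refine Runs.mono (runs_dnpCell hδ hx hs hk ha hh hr hc) le_rfl ?_
      rintro s hs ⟨hk, ha, hh, hr, hc⟩
      exact ⟨ha, by simpa using hk, hh, hr, hc⟩
    · rintro s hs ⟨hk, hh, hr, hc⟩
      refine ⟨hk, hh, fun l hl b => ?_⟩
      rcases hl.lt_or_eq with h | rfl
      · exact hr l (Nat.lt_succ_iff.1 h) b
      · exact hc b b.2
  · rintro s hs ⟨hh, hr⟩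
    refine ⟨hh, fun b => ?_, fun b => ?_⟩
    · have := hr 0 (Nat.zero_le n) b
      rw [truncPayoff_zero (hδ.abs_le_one G.lam_pos G.lam_lt_one b)] at this
      simpa using this
    · rw [hr n le_rfl b, hδ.truncPayoff_card G.lam_pos G.lam_lt_one]

theorem isShort_slack {a b : Fin n} (hxs : ∀ a, G.IsShort 50 (x a)) (hab : G.E a b) :
    G.IsShort 104 (G.slack x a b) :=
  ((isShort_sgn _).mul (((hxs a).sub (isShort_weight hab)).sub (isShort_lam.mul (hxs b)))).mono
    (by norm_num)

theorem isShort_rate (hδ : IsDNPValue G.lam G.owner (G.tight x) δ) (a b : Fin n) :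
    G.IsShort 4 (G.rate δ a b) :=
  (isShort_sgn _).mul ((isShort_lam.mul (isShort_dnpValue hδ b)).sub (isShort_dnpValue hδ a))

/-- Comparing `m * slack` with the rate avoids dividing by a zero slack: on tight edges the rate is
at most `0`, so the test fails there. -/
theorem runs_stepLength (hδ : IsDNPValue G.lam G.owner (G.tight x) δ) (hx : x ∈ G.optPol)
    (hxs : ∀ a, G.IsShort 50 (x a)) (hst : G.ShortStore st) (hh : G.Holds x st)
    (h0 : ∀ b : Fin n, st.d b = 0) (hd : ∀ b : Fin n, st.d (n * n + b) = δ b) :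
    G.Runs st Solver.stepLength (3 + (n * (n * (200 + 12) + 9 + 12) + 9)) fun s =>
      G.Holds x s ∧ (∀ b : Fin n, s.d b = 0) ∧ (∀ b : Fin n, s.d (n * n + b) = δ b) ∧
        G.IsStepBound x δ (fun _ _ => True) s.m := by
  refine Runs.seq (Q := fun s => G.Holds x s ∧ s.d = st.d ∧ s.m = 0) (Runs.mono (Runs.setM (v := 0)
    hst (by simp [RExp.eval]) (isShort_zero.mono (by norm_num)) ⟨hh, rfl, rfl⟩) (by decide)
    fun _ _ h => h) ?_
  rintro s hs ⟨hh, hsd, hm⟩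
  refine Runs.mono (Runs.forNodes (T := n * (200 + 12) + 9) (Inv := fun i s => G.Holds x s ∧
    s.d = st.d ∧ G.IsStepBound x δ (fun a _ => a < i) s.m) hs ?_ ?_) le_rfl ?_
  · exact ⟨hh, hsd, fun a b h => absurd h (Nat.not_lt_zero _), Or.inl hm⟩
  · rintro a s hs ha ⟨hh, hsd, hb1, hb2⟩
    refine Runs.mono (Runs.forNodes (T := 200) (Inv := fun i s => s.c 1 = a ∧ G.Holds x s ∧
      s.d = st.d ∧ G.IsStepBound x δ (fun c d => c < a ∨ c = a ∧ d < i) s.m) hs ?_ ?_) le_rfl ?_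
    · refine ⟨by simpa using ha, hh, hsd, ?_, hb2⟩
      rintro c d (h | h) hcd
      · exact hb1 c d h hcd
      · exact absurd h.2 (Nat.not_lt_zero _)
    · rintro b s hs hb ⟨ha, hh, hsd, hb1, hb2⟩
      have hrate : (Solver.rate Solver.lastRow Solver.lastRow).eval (G.memory s) =
          G.rate δ a b := by
        rw [eval_rate ha hb (hh a).1, eval_lastRow, hsd, hd, hd, rate]
      have hcond : (BExp.and Solver.edgeTest (.ltR (.mul Solver.best Solver.slack)
          (Solver.rate Solver.lastRow Solver.lastRow))).Holds (G.memory s) ↔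
          G.E a b ∧ s.m * G.slack x a b < G.rate δ a b := by
        simp only [BExp.Holds, holds_edgeTest ha hb, RExp.eval, hrate, eval_best]
        refine and_congr_right fun hab => ?_
        rw [eval_slack ha hb hab (hh a).1 fun a => (hh a).2]
      have hsplit : ∀ c d : Fin n, (c < a ∨ c = a ∧ (d : ℕ) < b + 1) →
          (c < a ∨ c = a ∧ (d : ℕ) < b) ∨ c = a ∧ d = b := by
        rintro c d (h | ⟨h1, h2⟩)
        · exact Or.inl (Or.inl h)
        · rcases (Nat.lt_succ_iff.1 h2).lt_or_eq with h | h
          · exact Or.inl (Or.inr ⟨h1, h⟩)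
          · exact Or.inr ⟨h1, Fin.ext h⟩
      refine Runs.mono (Runs.ite (T := 90) ?_ ?_) (by decide) fun _ _ h => h
      · intro h
        obtain ⟨hab, hlt⟩ := hcond.1 h
        have hm0 : 0 ≤ s.m := IsStepBound.nonneg hδ hx ⟨hb1, hb2⟩
        have hr : 0 < G.rate δ a b :=
          (mul_nonneg hm0 (mem_optPol_iff.1 hx a b hab)).trans_lt hlt
        have hs0 := slack_pos_of_rate_pos hx hδ hab hr
        refine Runs.mono (Runs.setM (v := G.rate δ a b / G.slack x a b) hs ?_
          (((isShort_rate hδ a b).div (isShort_slack hxs hab)).mono (by norm_num)) ?_) (by decide)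
          fun _ _ h => h
        · simp only [RExp.eval, hrate, eval_slack ha hb hab (hh a).1 fun a => (hh a).2]
        · refine ⟨hb, by simpa using ha, hh, hsd, ?_, Or.inr ⟨a, b, hab, hr, rfl⟩⟩
          intro c d hP hcd
          rcases hsplit c d hP with h | ⟨rfl, rfl⟩
          · refine (hb1 c d h hcd).trans ?_
            refine mul_le_mul_of_nonneg_right ?_ (mem_optPol_iff.1 hx c d hcd)
            rw [le_div_iff₀ hs0]
            exact hlt.le
          · rw [div_mul_cancel₀ _ hs0.ne']
      · intro h
        rw [hcond, not_and, not_lt] at h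
        refine Runs.mono (Runs.skip hs ?_) (by norm_num) fun _ _ h => h
        refine ⟨hb, by simpa using ha, hh, hsd, fun c d hP hcd => ?_, hb2⟩
        rcases hsplit c d hP with h' | ⟨rfl, rfl⟩
        · exact hb1 c d h' hcd
        · exact h hcd
    · rintro s hs ⟨ha, hh, hsd, hb1, hb2⟩
      refine ⟨ha, hh, hsd, fun c d hc hcd => hb1 c d ?_ hcd, hb2⟩
      rcases (Nat.lt_succ_iff.1 hc).lt_or_eq with h | h
      · exact Or.inl h
      · exact Or.inr ⟨Fin.ext h, d.2⟩
  · rintro s hs ⟨hh, hsd, hb1, hb2⟩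
    exact ⟨hh, fun b => by rw [hsd, h0], fun b => by rw [hsd, hd],
      fun a b _ hab => hb1 a b a.2 hab, hb2⟩

end DiscountedGame

/-! ### The main loop and the resource bounds. -/

namespace DiscountedGame

variable {n : ℕ} {G : DiscountedGame n} {st : Store} {x δ : Fin n → ℝ}

/-- At the sinks of the graph of tight edges, `x` has the values `t` and `- t` with the same `t`. -/
def IsUniformOnSinks (G : DiscountedGame n) (x : Fin n → ℝ) : Prop :=
  ∃ t, ∀ a, (∀ b, ¬ G.tight x a b) → x a = (G.owner a).sgn * t

/-- Optimal edges stay tight, so every sink of the new tight graph was already a sink. There `δ` is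
minus the sign of the owner, and the common parameter `t` becomes `t - m⁻¹`. -/
theorem IsStepBound.step [NeZero n] (hδ : IsDNPValue G.lam G.owner (G.tight x) δ)
    (hx : x ∈ G.optPol) (ht : G.IsUniformOnSinks x) {m : ℝ}
    (h : G.IsStepBound x δ (fun _ _ => True) m) (hm : 0 < m) :
    x + m⁻¹ • δ ∈ G.optPol ∧ (∀ a, G.IsShort 50 ((x + m⁻¹ • δ) a)) ∧
      G.IsUniformOnSinks (x + m⁻¹ • δ) ∧
      DNPStep G.lam G.owner (G.tight x) (G.tight (x + m⁻¹ • δ)) := by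
  obtain ⟨t, ht⟩ := ht
  rcases h.2 with e | ⟨a, b, hab, hr, e⟩
  · exact absurd e hm.ne'
  have hs0 := slack_pos_of_rate_pos hx hδ hab hr
  have hnew : G.tight (x + m⁻¹ • δ) a b := by
    refine tight_iff.2 ⟨hab, ?_⟩
    rw [slack_add, e, inv_div, div_mul_cancel₀ _ hr.ne', sub_self]
  have hsink : ∀ a, (∀ b, ¬ G.tight x a b) →
      (x + m⁻¹ • δ) a = (G.owner a).sgn * (t - m⁻¹) := by
    intro a ha
    rcases hδ.eq_or a with ⟨b, hb, -⟩ | ⟨-, e⟩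
    · exact absurd hb (ha b)
    · simp only [Pi.add_apply, Pi.smul_apply, smul_eq_mul, ht a ha, e]
      ring
  refine ⟨mem_optPol_iff.2 fun c d hcd => ?_,
    isShort_of_tight hδ (fun _ _ h e => tight_add h e) hsink hnew hr.ne', ⟨t - m⁻¹, fun a ha => ?_⟩,
    dnpStep_of_tight hδ (fun _ _ h => h) hnew hr⟩
  · rw [slack_add, sub_nonneg, inv_mul_le_iff₀ hm]
    exact h.1 c d trivial hcd
  · refine hsink a fun b hab => ?_
    rcases hδ.eq_or a with ⟨c, hc, e⟩ | ⟨hc, -⟩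
    · exact ha c (tight_add hc e)
    · exact hc b hab

theorem IsStepBound.optimalityEquations (hδ : IsDNPValue G.lam G.owner (G.tight x) δ)
    (hx : x ∈ G.optPol) {m : ℝ} (h : G.IsStepBound x δ (fun _ _ => True) m) (hm : ¬ 0 < m) :
    G.OptimalityEquations x := by
  have hm0 : m = 0 := le_antisymm (not_lt.1 hm) (h.nonneg hδ hx)
  refine optimalityEquations_of_rate_nonpos hx hδ fun a b hab => ?_
  have := h.1 a b trivial hab
  rwa [hm0, zero_mul] at this

/-- After `i` iterations the store holds a point of the optimality polyhedron reached by a DNP games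
iteration with `i` steps, or else the variable `m` is not positive and the store holds
the vector of values. -/
def LoopInvariant (G : DiscountedGame n) (i : ℕ) (s : Store) : Prop :=
  (∀ b : Fin n, s.d b = 0) ∧ ∃ x, G.Holds x s ∧
    (0 < s.m → x ∈ G.optPol ∧ (∀ a, G.IsShort 50 (x a)) ∧ G.IsUniformOnSinks x ∧
      ∃ H : ℕ → Fin n → Fin n → Prop,
        (∀ l < i, DNPStep G.lam G.owner (H l) (H (l + 1))) ∧ H i = G.tight x) ∧
    (¬ 0 < s.m → G.OptimalityEquations x)

theorem input_eq_memory :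
    G.input = G.memory ⟨fun _ => 0, fun _ => 0, fun _ => 0, fun _ => 0, 0⟩ := by
  set m := G.memory ⟨fun _ => 0, fun _ => 0, fun _ => 0, fun _ => 0, 0⟩
  have hN : G.input.N = m.N := by
    funext q i
    rcases q with _ | _ | _ | q <;> simp [m, memory, input]
  have hR : G.input.R = m.R := by
    funext q i
    rcases q with _ | _ | _ | _ | _ | _ | q <;> simp [m, memory, input]
  calc G.input = ⟨G.input.N, G.input.R⟩ := rfl
    _ = m := by rw [hN, hR]

variable [NeZero n]

theorem runs_iteration {i : ℕ} (hst : G.ShortStore st) (hinv : G.LoopInvariant i st)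
    (hm : 0 < st.m) :
    G.Runs st (.seq Solver.dnpValues (.seq Solver.stepLength Solver.move)) (524 * n ^ 3)
      (G.LoopInvariant (i + 1)) := by
  obtain ⟨h0, x, hh, hpos, -⟩ := hinv
  obtain ⟨hx, hxs, hxt, H, hH, hHi⟩ := hpos hm
  obtain ⟨δ, hδ⟩ := exists_isDNPValue G.owner (G.tight x) G.lam_pos G.lam_lt_one
  refine Runs.mono (Runs.seq (T' := (n * (n * 212 + 21) + 12) + (5 + (n * (40 + 12) + 9)))
    (runs_dnpValues hδ hx hst hh h0) ?_) ?_ fun _ _ h => h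
  · rintro s hs ⟨hh, h0, hd⟩
    refine Runs.mono (Runs.seq (T' := 5 + (n * (40 + 12) + 9))
      (runs_stepLength hδ hx hxs hs hh h0 hd) ?_) (le_of_eq ?_) fun _ _ h => h
    · rintro s hs ⟨hh, h0, hd, hb⟩
      refine Runs.mono (runs_move hs hh h0 hd fun hm => (hb.step hδ hx hxt hm).2.1) le_rfl ?_
      rintro s' hs' ⟨h0', hsm, hh'⟩
      refine ⟨h0', _, hh', ?_, ?_⟩
      · intro hm
        rw [hsm] at hm
        rw [if_pos hm]
        obtain ⟨h1, h2, h3, h4⟩ := hb.step hδ hx hxt hm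
        refine ⟨h1, h2, h3, fun l => if l ≤ i then H l else G.tight (x + s.m⁻¹ • δ),
          fun l hl => ?_, by simp⟩
        rcases (Nat.lt_succ_iff.1 hl).lt_or_eq with h | rfl
        · simpa [h.le, Nat.succ_le_of_lt h] using hH l h
        · simpa [hHi] using h4
      · intro hm
        rw [hsm] at hm
        rw [if_neg hm]
        exact hb.optimalityEquations hδ hx hm
    · ring
  · have h1 : 1 ≤ n := NeZero.pos n
    have h2 : n ≤ n ^ 2 := Nat.le_self_pow (by norm_num) n
    have h3 : n ^ 2 ≤ n ^ 3 := Nat.pow_le_pow_right h1 (by norm_num)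
    nlinarith

theorem runs_program (hst : G.ShortStore st) (hm : st.m = 0) (hd : ∀ i, st.d i = 0) :
    G.Runs st Solver.program
      (191 * n ^ 3 + ⌊4 * n * (2 + √2) ^ n⌋₊ * (529 * n ^ 3))
      fun s => G.OptimalityEquations fun a => s.x a := by
  have h1 : 1 ≤ n := NeZero.pos n
  have h2 : n ≤ n ^ 2 := Nat.le_self_pow (by norm_num) n
  have h3 : n ^ 2 ≤ n ^ 3 := Nat.pow_le_pow_right h1 (by norm_num)
  have hcost : (BExp.ltR (.lit 0) Solver.best).cost = 4 := by decide
  refine Runs.mono (Runs.seq (T' := (20 + (n * (40 + 12) + 9)) +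
    (3 + (⌊4 * n * (2 + √2) ^ n⌋₊ * (5 + 524 * n ^ 3) + 5))) (runs_maxWeight hst hm) ?_) ?_
    fun _ _ h => h
  · rintro s hs ⟨hsd, hms, hmw⟩
    refine Runs.seq (runs_initialPoint hs hms hmw) ?_
    rintro s hs ⟨hsd', t, hts, hpol, hst⟩
    refine Runs.seq (Q := G.LoopInvariant 0) (Runs.mono (Runs.setM (v := 1) hs (by simp [RExp.eval])
      (isShort_one.mono (by norm_num)) ?_) (by decide) fun _ _ h => h) ?_
    · refine ⟨fun b => ?_, fun a => (G.owner a).sgn * t, fun a => hst a, fun _ =>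
        ⟨hpol, fun a => ((isShort_sgn _).mul hts).mono (by norm_num), ⟨t, fun _ _ => rfl⟩,
          fun _ => G.tight fun a => (G.owner a).sgn * t, fun l hl => absurd hl (Nat.not_lt_zero l),
          rfl⟩, fun h => absurd one_pos h⟩
      dsimp only
      rw [hsd', hsd, hd]
    · intro s hs hinv
      refine Runs.mono (Runs.loop (Inv := G.LoopInvariant) (L := ⌊4 * n * (2 + √2) ^ n⌋₊) hs hinv
        (T := 524 * n ^ 3) ?_) (by rw [hcost]) ?_
      · intro i s hs hinv hb
        simp only [BExp.Holds, RExp.eval, eval_best, Nat.cast_zero] at hb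
        refine ⟨?_, runs_iteration hs hinv hb⟩
        obtain ⟨-, x, -, hpos, -⟩ := hinv
        obtain ⟨-, -, -, H, hH, -⟩ := hpos hb
        -- The invariant carries a chain of `i` steps, hence of `i + 1` graphs, so the bound on
        -- chains limits the number of iterations.
        refine Nat.lt_of_succ_le (Nat.le_floor ?_)
        push_cast
        exact DNPStep.chain_le (NeZero.pos n) G.lam_pos G.lam_lt_one H i hH
      · rintro s hs ⟨hb, i, -, x, hh, -, hopt⟩
        simp only [BExp.Holds, RExp.eval, eval_best, Nat.cast_zero] at hb
        have : (fun a : Fin n => s.x a) = x := funext fun a => (hh a).2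
        rw [this]
        exact hopt hb
  · have h4 : ⌊4 * (n : ℝ) * (2 + √2) ^ n⌋₊ * (5 + 524 * n ^ 3) ≤
        ⌊4 * (n : ℝ) * (2 + √2) ^ n⌋₊ * (529 * n ^ 3) :=
      Nat.mul_le_mul_left _ (by omega)
    nlinarith

theorem input_N_spec (q i : ℕ) : G.input.N q i ≤ n ∧ (n * n + n ≤ i → G.input.N q i = 0) := by
  have h1 : 1 ≤ n := NeZero.pos n
  simp only [input]
  split_ifs with h2 h3 h4
  · exact ⟨le_rfl, fun h => by omega⟩
  · obtain ⟨-, a, -, e⟩ := h3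
    exact ⟨h1, fun h => absurd (node_lt a) (by omega)⟩
  · obtain ⟨-, a, b, -, e⟩ := h4
    exact ⟨h1, fun h => absurd (row_lt a.2.le b) (by omega)⟩
  · exact ⟨Nat.zero_le n, fun _ => rfl⟩

theorem input_R_spec (q i : ℕ) :
    G.IsShort 1000 (G.input.R q i) ∧ (n * n + n ≤ i → G.input.R q i = 0) := by
  have h1 : 1 ≤ n := NeZero.pos n
  by_cases h0 : q = 0 ∧ i = 0
  · obtain ⟨rfl, rfl⟩ := h0
    have : G.input.R 0 0 = G.lam := by simp [input]
    rw [this]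
    exact ⟨isShort_lam.mono (by norm_num), fun h => by omega⟩
  by_cases hq : q = 1
  · subst hq
    by_cases hi : ∃ a b : Fin n, G.E a b ∧ i = a * n + b
    · obtain ⟨a, b, hab, rfl⟩ := hi
      have : G.input.R 1 (a * n + b) = G.w a b :=
        memory_weight (st := ⟨fun _ => 0, fun _ => 0, fun _ => 0, fun _ => 0, 0⟩) hab
      rw [this]
      exact ⟨(isShort_weight hab).mono (by norm_num),
        fun h => absurd (row_lt a.2.le b) (by omega)⟩
    · have : G.input.R 1 i = 0 := by
        simp only [input]
        rw [if_neg h0, if_pos trivial]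
        exact Finset.sum_eq_zero fun a _ => Finset.sum_eq_zero fun b _ =>
          if_neg fun h => hi ⟨a, b, h⟩
      rw [this]
      exact ⟨isShort_zero.mono (by norm_num), fun _ => rfl⟩
  · have : G.input.R q i = 0 := by
      simp only [input]
      rw [if_neg h0, if_neg hq]
    rw [this]
    exact ⟨isShort_zero.mono (by norm_num), fun _ => rfl⟩

theorem ShortStore.memory_N (hst : G.ShortStore st) (q i : ℕ) :
    (G.memory st).N q i ≤ n ∧ (n * n + n ≤ i → (G.memory st).N q i = 0) := by
  have h1 : 1 ≤ n := NeZero.pos n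
  rcases q with _ | _ | _ | q
  · exact input_N_spec 0 i
  · exact input_N_spec 1 i
  · exact input_N_spec 2 i
  · simp only [memory]
    split_ifs with h
    · exact ⟨hst.c q, fun h' => by omega⟩
    · exact ⟨Nat.zero_le n, fun _ => rfl⟩

theorem ShortStore.memory_R (hst : G.ShortStore st) (q i : ℕ) :
    G.IsShort 1000 ((G.memory st).R q i) ∧ (n * n + n ≤ i → (G.memory st).R q i = 0) := by
  have h1 : 1 ≤ n := NeZero.pos n
  rcases q with _ | _ | _ | _ | _ | _ | q
  · exact input_R_spec 0 i
  · exact input_R_spec 1 i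
  · exact ⟨hst.x.2 i, hst.x.1 i⟩
  · exact ⟨hst.d.2 i, hst.d.1 i⟩
  · exact ⟨hst.sg.2 i, hst.sg.1 i⟩
  · simp only [memory]
    split_ifs with h
    · exact ⟨hst.m, fun h' => by omega⟩
    · exact ⟨isShort_zero.mono (by norm_num), fun _ => rfl⟩
  · exact input_R_spec (q + 6) i

theorem ShortStore.memory_spec (hst : G.ShortStore st) :
    (G.memory st).FitsIn (3000 * n ^ 4) ∧ ∀ B, G.HasBitLength B → ∀ j i,
      _root_.HasBitLength (3000 * (n * B) ^ 4) ((G.memory st).R j i) := by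
  have h1 : 1 ≤ n := NeZero.pos n
  have h2 : n ^ 1 ≤ n ^ 4 := Nat.pow_le_pow_right h1 (by norm_num)
  have h3 : n ^ 2 ≤ n ^ 4 := Nat.pow_le_pow_right h1 (by norm_num)
  have h4 : n * n + n ≤ 3000 * n ^ 4 := by nlinarith
  have h5 : n < 3000 * n ^ 4 := by nlinarith
  refine ⟨⟨fun k i hi => ⟨(hst.memory_N k i).2 (h4.trans hi), (hst.memory_R k i).2 (h4.trans hi)⟩,
    fun k i => (hst.memory_N k i).1.trans_lt h5⟩, fun B hB j i => ?_⟩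
  refine ((hst.memory_R j i).1 B hB).hasBitLength.mono ?_
  have hB1 := hB.pos
  have h6 := hB.one_le_sq_mul
  have h7 : n ^ 2 * B ≤ (n * B) ^ 4 := by
    rw [mul_pow]
    exact Nat.mul_le_mul h3 (Nat.le_self_pow (by norm_num) B)
  omega

theorem exec_program : ∃ (t : ℕ) (s : Mem),
    Exec (fun m => m.FitsIn (3000 * n ^ 4) ∧
      ∀ B : ℕ, G.HasBitLength B → ∀ j i, _root_.HasBitLength (3000 * (n * B) ^ 4) (m.R j i))
      Solver.program G.input t s ∧
    (t : ℝ) ≤ (3000 : ℕ) * (n : ℝ) ^ 4 * (2 + √2) ^ n ∧ G.IsValueVector (s.output n) := by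
  have harr : G.ShortArray fun _ => 0 := ⟨fun _ _ => rfl, fun _ => isShort_zero.mono (by norm_num)⟩
  have hst : G.ShortStore ⟨fun _ => 0, fun _ => 0, fun _ => 0, fun _ => 0, 0⟩ :=
    ⟨fun _ => Nat.zero_le n, harr, harr, harr, isShort_zero.mono (by norm_num)⟩
  obtain ⟨t, st', he, ht, hst', hopt⟩ := runs_program hst rfl fun _ => rfl
  rw [← input_eq_memory] at he
  refine ⟨t, G.memory st', he.mono ?_, ?_, hopt.isValueVector⟩
  · rintro _ ⟨st, hst, rfl⟩
    exact hst.memory_spec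
  · have h1 : (1 : ℝ) ≤ n := by exact_mod_cast NeZero.pos n
    have hr : (1 : ℝ) ≤ (2 + √2) ^ n := one_le_pow₀ (by linarith [Real.sqrt_nonneg 2])
    have hfl := Nat.floor_le (a := 4 * (n : ℝ) * (2 + √2) ^ n) (by positivity)
    have ht' : (t : ℝ) ≤ 191 * n ^ 3 + ⌊4 * (n : ℝ) * (2 + √2) ^ n⌋₊ * (529 * n ^ 3) := by
      exact_mod_cast ht
    have h3 : (n : ℝ) ^ 3 ≤ n ^ 4 * (2 + √2) ^ n := by
      calc (n : ℝ) ^ 3 ≤ n ^ 4 := pow_le_pow_right₀ h1 (by norm_num)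
        _ ≤ n ^ 4 * (2 + √2) ^ n := le_mul_of_one_le_right (by positivity) hr
    have h4 : (⌊4 * (n : ℝ) * (2 + √2) ^ n⌋₊ : ℝ) * (529 * n ^ 3) ≤
        4 * (n : ℝ) * (2 + √2) ^ n * (529 * n ^ 3) :=
      mul_le_mul_of_nonneg_right hfl (by positivity)
    -- Time needs `191 + 2116`, and bit-lengths need `2 * 1000 + 2`; `3000` covers both.
    have h5 : 4 * (n : ℝ) * (2 + √2) ^ n * (529 * n ^ 3) = 2116 * (n ^ 4 * (2 + √2) ^ n) := by ring
    push_cast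
    linarith

end DiscountedGame

theorem theorem1 :
    -- one program, for all numbers of nodes and all real games
    (∃ (P : Prog) (C k : ℕ), ∀ n : ℕ, 0 < n → ∀ G : DiscountedGame n, ∃ (t : ℕ) (s : Mem),
      Exec
        (fun m => m.FitsIn (C * n ^ k) ∧
          ∀ B : ℕ, G.HasBitLength B → ∀ j i, HasBitLength (C * (n * B) ^ k) (m.R j i))
        P G.input t s ∧
      (t : ℝ) ≤ C * (n : ℝ) ^ k * (2 + √2) ^ n ∧
      G.IsValueVector (s.output n)) ∧
    -- polyhedral value iteration can proceed until the optimality equations hold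
    (∀ (n : ℕ) (G : DiscountedGame n), ∀ x ∈ G.optPol, ¬ G.OptimalityEquations x →
      ∃ x', G.PolyStep x x') ∧
    -- its graphs of tight edges form a DNP games iteration
    (∀ (n : ℕ) (G : DiscountedGame n) (x x' : Fin n → ℝ), G.PolyStep x x' →
      DNPStep G.lam G.owner (G.tight x) (G.tight x')) ∧
    -- every DNP games iteration `H 0, …, H j` is short
    (∃ C : ℝ, ∀ n : ℕ, 0 < n → ∀ (lam : ℝ), 0 < lam → lam < 1 →
      ∀ (owner : Fin n → Player) (H : ℕ → Fin n → Fin n → Prop) (j : ℕ),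
        (∀ i < j, DNPStep lam owner (H i) (H (i + 1))) →
        ((j : ℝ) + 1) ≤ C * n * (2 + √2) ^ n) := by
  refine ⟨⟨Solver.program, 3000, 4, fun n hn G => ?_⟩, fun n G x hx hne => DiscountedGame.exists_polyStep hx hne,
    fun n G x x' h => h.dnpStep, 4, fun n hn lam h0 h1 owner H j hH => DNPStep.chain_le hn h0 h1 H j hH⟩
  have : NeZero n := ⟨hn.ne'⟩
  exact DiscountedGame.exec_program
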